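/- **Setting.** Let $r\in C^1[1,2)$ be the solution of $$r'(t)=\sqrt{2/\pi}\;r(t)^2\sqrt{r(t)-\pi/2}\quad (1<t<2),\qquad r(1)=\pi/2,\qquad r>\pi/2 \text{ on } (1,2),$$ extended to $(0,2)$ by $r(t):=r(2-t)$ for $t\in(0,1)$. Put $\ell(t):=1/r(t)$ and $$\rho_m(t,x):=-\frac{r(t)}{2\pi}\Big(1-\frac{x^2}{\ell(t)^2}\Big)_+,\qquad (t,x)\in(0,2)\times\mathbb R .$$ Let $p(t,x):=\exp(-x^2/2t)/\sqrt{2\pi t}$. For $t>0$ and $y\in\mathbb R$ let $\mathbb E_{0\to y}$ denote the expectation over a Brownian bridge $B$ on $[0,t]$ from $B(0)=0$ to $B(t)=y$. For $\lambda>0$ set $$h_\lambda(\rho_m;t,x):=\lambda^{-1}\log\!\big(\sqrt{4\pi}\,p(t,\lambda^{1/2}x)\big)+\lambda^{-1}\log \mathbb E_{0\to\lambda^{1/2}x}\Big[\exp\Big(\int_0^t\lambda\,\rho_m\big(s,\lambda^{-1/2}B(s)\big)\,ds\Big)\Big].$$ Let $H^1_{0,x}[0,t]$ be the set of $H^1$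 functions $\gamma$ on $[0,t]$ (absolutely continuous with square-integrable derivative) such that $\gamma(0)=0$ and $\gamma(t)=x$, and for such $\gamma$ let $$E(\gamma;t,x):=\int_0^t\Big(\tfrac12\gamma'(s)^2-\rho_m(s,\gamma(s))\Big)\,ds .$$ **Lemma.** Let $(t,x)\in(0,2]\times\mathbb R$. The quantities above are well defined: $s\mapsto\rho_m(s,\gamma(s))$ is integrable on $[0,t]$ for every continuous $\gamma:[0,t]\to\mathbb R$, and the random variable inside the expectation $\mathbb E_{0\to\lambda^{1/2}x}$ is integrable for every $\lambda>0$. Moreover, $h_\lambda(\rho_m;t,x)$ converges to a finite limit as $\lambda\to\infty$, and $$\lim_{\lambda\to\infty}h_\lambda(\rho_m;t,x)=-\inf\big\{E(\gamma;t,x):\gamma\in H^1_{0,x}[0,t]\big\},$$ where the infimum is that of a nonempty set of real numbers bounded below. -/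

import Mathlib

open MeasureTheory ProbabilityTheory Filter Topology

noncomputable section

namespace WeakNoise

/-! ### Brownian bridges and the Feynman–Kac functional -/

/-- `b` is, under `P`, a Brownian bridge on the time interval `[0, t]` from `b 0 = 0` to `b t = y`:
a Gaussian process with mean `(s / t) y`, covariance `s (t - u) / t` for `s ≤ u`, and almost surely
continuous paths. (The values of `b` outside `[0, t]` are irrelevant. At `s = 0` and `s = t` the
variance vanishes, so `b 0 = 0` and `b t = y` almost surely.) -/
structure IsBrownianBridge {Ω : Type*} [MeasurableSpace Ω] (t y : ℝ) (b : ℝ → Ω → ℝ)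
    (P : Measure Ω) : Prop where
  gaussian : IsGaussianProcess (fun (s : Set.Icc (0 : ℝ) t) (ω : Ω) => b s ω) P
  mean : ∀ s ∈ Set.Icc (0 : ℝ) t, ∫ ω, b s ω ∂P = s / t * y
  covariance : ∀ s ∈ Set.Icc (0 : ℝ) t, ∀ u ∈ Set.Icc (0 : ℝ) t, s ≤ u →
    cov[b s, b u; P] = s * (t - u) / t
  continuous_paths : ∀ᵐ ω ∂P, ContinuousOn (fun s => b s ω) (Set.Icc 0 t)

/-- The standard heat kernel `p(t, x) = exp(-x² / 2t) / √(2πt)`. -/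
def heatKernel (t x : ℝ) : ℝ :=
  Real.exp (-x ^ 2 / (2 * t)) / √(2 * Real.pi * t)

/-- The random variable `exp (∫₀ᵗ ρ(s, b(s)) ds)`. -/
def expFunctional {Ω : Type*} (ρ : ℝ → ℝ → ℝ) (t : ℝ) (b : ℝ → Ω → ℝ) (ω : Ω) : ℝ :=
  Real.exp (∫ s in (0 : ℝ)..t, ρ s (b s ω))

/-- `h(ρ; t, x) = log (√(4π) p(t, x)) + log E_{0 → x} [exp (∫₀ᵗ ρ(s, b(s)) ds)]`, where `b` is, under
`P`, a Brownian bridge on `[0, t]` from `0` to `x`. The value depends only on the law of `b`. -/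
def feynmanKac {Ω : Type*} [MeasurableSpace Ω] (ρ : ℝ → ℝ → ℝ) (t x : ℝ) (P : Measure Ω)
    (b : ℝ → Ω → ℝ) : ℝ :=
  Real.log (√(4 * Real.pi) * heatKernel t x) + Real.log (∫ ω, expFunctional ρ t b ω ∂P)

/-- The rescaled potential `(s, y) ↦ l ρ(s, l^{-1/2} y)`. -/
def rescale (l : ℝ) (ρ : ℝ → ℝ → ℝ) (s y : ℝ) : ℝ :=
  l * ρ s (y / √l)

/-- `h_l(ρ; t, x) = l⁻¹ h(l ρ(·, l^{-1/2} ·); t, l^{1/2} x)`, that is,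
`l⁻¹ log (√(4π) p(t, l^{1/2} x))
  + l⁻¹ log E_{0 → l^{1/2} x} [exp (∫₀ᵗ l ρ(s, l^{-1/2} b(s)) ds)]`,
where `b` is, under `P`, a Brownian bridge on `[0, t]` from `0` to `l^{1/2} x`. -/
def feynmanKacScaled {Ω : Type*} [MeasurableSpace Ω] (l : ℝ) (ρ : ℝ → ℝ → ℝ) (t x : ℝ)
    (P : Measure Ω) (b : ℝ → Ω → ℝ) : ℝ :=
  l⁻¹ * feynmanKac (rescale l ρ) t (√l * x) P b

/-! ### The optimal deviation -/

/-- `r` is the `C¹[1, 2)` solution of `r' = 2^{1/2} π^{-1/2} r² √(r - π/2)` on `(1, 2)` with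
`r(1) = π/2` and `r > π/2` on `(1, 2)`, extended to `(0, 1)` by `r(t) = r(2 - t)`.
The values of `r` outside `(0, 2)` are irrelevant. -/
structure IsOptimalProfile (r : ℝ → ℝ) : Prop where
  contDiffOn : ContDiffOn ℝ 1 r (Set.Ico 1 2)
  ode : ∀ t ∈ Set.Ioo (1 : ℝ) 2,
    HasDerivAt r (√2 / √Real.pi * r t ^ 2 * √(r t - Real.pi / 2)) t
  init : r 1 = Real.pi / 2
  gt : ∀ t ∈ Set.Ioo (1 : ℝ) 2, Real.pi / 2 < r t
  symm : ∀ t ∈ Set.Ioo (0 : ℝ) 1, r t = r (2 - t)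

/-- `ℓ(t) = 1 / r(t)`, used for `t ∈ (0, 2)` only. -/
def ell (r : ℝ → ℝ) (t : ℝ) : ℝ := 1 / r t

/-- The optimal deviation `ρ_m(t, x) = -(r(t) / 2π) (1 - x² / ℓ(t)²)₊`, for `t ∈ (0, 2)`. -/
def optimalDeviation (r : ℝ → ℝ) (t x : ℝ) : ℝ :=
  -(r t / (2 * Real.pi)) * max (1 - x ^ 2 / ell r t ^ 2) 0

/-! ### The path variational problem -/

/-- The space `H¹_{0,x}[0, t]` of `H¹` paths on `[0, t]` from `0` to `x`: absolutely continuous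
functions on `[0, t]` with square-integrable derivative. -/
def H1Path (t x : ℝ) : Set (ℝ → ℝ) :=
  {γ | AbsolutelyContinuousOnInterval γ 0 t ∧
    MemLp (deriv γ) 2 (volume.restrict (Set.Icc 0 t)) ∧ γ 0 = 0 ∧ γ t = x}

/-- The energy `E(γ; t, x) = ∫₀ᵗ (γ'(s)² / 2 - ρ(s, γ(s))) ds` of a path `γ` from `(0, 0)` to
`(t, x)`; the endpoint `x` is `γ t`. -/
def energy (ρ : ℝ → ℝ → ℝ) (t : ℝ) (γ : ℝ → ℝ) : ℝ :=
  ∫ s in (0 : ℝ)..t, (deriv γ s ^ 2 / 2 - ρ s (γ s))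

/-! ### The profile `r` exists -/

theorem strictMono_id_add_sin : StrictMono (fun u : ℝ => u + Real.sin u) := by
  intro a b hab
  have h1 : Real.sin b - Real.sin a = 2 * Real.sin ((b - a) / 2) * Real.cos ((b + a) / 2) :=
    Real.sin_sub_sin b a
  have h2 : |Real.sin ((b - a) / 2)| < (b - a) / 2 := by
    have := Real.abs_sin_lt_abs (x := (b - a) / 2) (by linarith : 0 < (b - a) / 2).ne'
    rwa [abs_of_pos (by linarith : 0 < (b - a) / 2)] at this
  have h3 := Real.abs_cos_le_one ((b + a) / 2)
  have h4 : |Real.sin ((b - a) / 2) * Real.cos ((b + a) / 2)| < (b - a) / 2 := by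
    rw [abs_mul]
    nlinarith [abs_nonneg (Real.sin ((b - a) / 2))]
  have := (abs_lt.1 h4).1
  show a + Real.sin a < b + Real.sin b
  nlinarith

theorem exists_inverse : ∃ g : ℝ ≃ₜ ℝ, ∀ u, g u = u + Real.sin u := by
  have hs : Function.Surjective (fun u : ℝ => u + Real.sin u) := by
    apply Continuous.surjective (by fun_prop)
    · exact tendsto_atTop_add_right_of_le _ (-1) tendsto_id (fun u => Real.neg_one_le_sin u)
    · exact tendsto_atBot_add_right_of_ge _ 1 tendsto_id (fun u => Real.sin_le_one u)
  exact ⟨(StrictMono.orderIsoOfSurjective _ strictMono_id_add_sin hs).toHomeomorph, fun u => rfl⟩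

/-- The defining properties of the profile can be met: with `u` determined by
`u + sin u = π (t - 1)`, the function `r = π / (1 + cos u)` has them. -/
theorem exists_isOptimalProfile : ∃ r : ℝ → ℝ, IsOptimalProfile r := by
  obtain ⟨g, hg⟩ := exists_inverse
  have hpi := Real.pi_pos
  have hmono : ∀ a b, g.symm a < g.symm b ↔ a < b := by
    intro a b
    rw [← strictMono_id_add_sin.lt_iff_lt]
    simp only [← hg, Homeomorph.apply_symm_apply]
  have hsymm : ∀ u s, u + Real.sin u = s → g.symm s = u := by
    intro u s h
    rw [← h, ← hg, Homeomorph.symm_apply_apply]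
  have hodd : ∀ s, g.symm (-s) = -g.symm s := by
    intro s
    apply hsymm
    have := hg (g.symm s)
    rw [Homeomorph.apply_symm_apply] at this
    rw [Real.sin_neg]; linarith
  have h0 : g.symm 0 = 0 := hsymm 0 0 (by simp)
  have hpi' : g.symm Real.pi = Real.pi := hsymm _ _ (by simp)
  set u : ℝ → ℝ := fun t => g.symm (Real.pi * (t - 1)) with hu
  have hub : ∀ t ∈ Set.Ico (1 : ℝ) 2, 0 ≤ u t ∧ u t < Real.pi := by
    intro t ht
    constructor
    · have := (hmono (Real.pi * (t - 1)) 0).not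
      rw [h0] at this
      exact not_lt.1 (this.2 (not_lt.2 (mul_nonneg hpi.le (by linarith [ht.1]))))
    · have := (hmono (Real.pi * (t - 1)) Real.pi).2 (by nlinarith [ht.2])
      rwa [hpi'] at this
  have hcos : ∀ t ∈ Set.Ico (1 : ℝ) 2, 0 < 1 + Real.cos (u t) := by
    intro t ht
    have h1 := Real.cos_lt_cos_of_nonneg_of_le_pi (hub t ht).1 le_rfl (hub t ht).2
    rw [Real.cos_pi] at h1
    linarith
  have hder : ∀ v, HasDerivAt g (1 + Real.cos v) v := by
    intro v
    have : (g : ℝ → ℝ) = fun u => u + Real.sin u := funext hg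
    rw [this]
    exact (hasDerivAt_id v).add (Real.hasDerivAt_sin v)
  have hud : ∀ t ∈ Set.Ico (1 : ℝ) 2, HasDerivAt u (Real.pi / (1 + Real.cos (u t))) t := by
    intro t ht
    have h1 : HasDerivAt g.symm (1 + Real.cos (u t))⁻¹ (Real.pi * (t - 1)) :=
      HasDerivAt.of_local_left_inverse g.symm.continuous.continuousAt (hder _) (hcos t ht).ne'
        (Eventually.of_forall fun y => g.apply_symm_apply y)
    have h2 : HasDerivAt (fun t : ℝ => Real.pi * (t - 1)) Real.pi t := by
      simpa using ((hasDerivAt_id t).sub_const 1).const_mul Real.pi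
    have h3 := h1.comp t h2
    rwa [inv_mul_eq_div] at h3
  have hucd : ∀ t ∈ Set.Ico (1 : ℝ) 2, ContDiffAt ℝ 1 u t := by
    intro t ht
    have h1 : ContDiffAt ℝ 1 g.symm (Real.pi * (t - 1)) := by
      refine g.toOpenPartialHomeomorph.contDiffAt_symm_deriv (hcos t ht).ne' (by simp)
        (hder _) ?_
      have : (g : ℝ → ℝ) = fun u => u + Real.sin u := funext hg
      simp only [Homeomorph.toOpenPartialHomeomorph_apply, this]
      exact contDiffAt_id.add Real.contDiff_sin.contDiffAt
    exact h1.comp t (contDiffAt_const.mul (contDiffAt_id.sub contDiffAt_const))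
  have hu1 : u 1 = 0 := by simp [hu, h0]
  refine ⟨fun t => Real.pi / (1 + Real.cos (u t)), ?_, ?_, ?_, ?_, ?_⟩
  · intro t ht
    exact (contDiffAt_const.div (contDiffAt_const.add
      (Real.contDiff_cos.contDiffAt.comp t (hucd t ht))) (hcos t ht).ne').contDiffWithinAt
  · intro t ht
    have ht' := Set.Ioo_subset_Ico_self ht
    have hc := hcos t ht'
    have hsin : 0 ≤ Real.sin (u t) :=
      Real.sin_nonneg_of_nonneg_of_le_pi (hub t ht').1 (hub t ht').2.le
    have hd := (hasDerivAt_const t Real.pi).div ((hud t ht').cos.const_add 1) hc.ne'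
    refine HasDerivAt.congr_deriv (f := fun t => Real.pi / (1 + Real.cos (u t))) hd ?_
    show _ = √2 / √Real.pi * (Real.pi / (1 + Real.cos (u t))) ^ 2 *
      √(Real.pi / (1 + Real.cos (u t)) - Real.pi / 2)
    have hsq : Real.pi / (1 + Real.cos (u t)) - Real.pi / 2
        = (Real.pi / 2) * (Real.sin (u t) / (1 + Real.cos (u t))) ^ 2 := by
      rw [div_pow, Real.sin_sq]
      field_simp
      ring
    rw [hsq, Real.sqrt_mul (by positivity), Real.sqrt_sq (by positivity),
      Real.sqrt_div hpi.le]
    have a1 : √Real.pi ≠ 0 := (Real.sqrt_pos.2 hpi).ne'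
    have a2 : √(2 : ℝ) ≠ 0 := by positivity
    field_simp
    ring
  · simp only [hu1, Real.cos_zero]; norm_num
  · intro t ht
    have ht' := Set.Ioo_subset_Ico_self ht
    have h1 : 0 < u t := by
      have := (hmono 0 (Real.pi * (t - 1))).2 (mul_pos hpi (by linarith [ht.1]))
      rwa [h0] at this
    have h2 := Real.cos_lt_cos_of_nonneg_of_le_pi le_rfl (hub t ht').2.le h1
    rw [Real.cos_zero] at h2
    exact div_lt_div_of_pos_left hpi (hcos t ht') (by linarith)
  · intro t ht
    have : u t = -u (2 - t) := by
      simp only [hu]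
      rw [← hodd]; congr 1; ring
    simp only [this, Real.cos_neg]

end WeakNoise

end

open WeakNoise

/-! This is Laplace's principle for the bridge, obtained by discretizing paths rather than from a
large deviation theorem on path space.

The potential is singular where `r` blows up, but `r` is integrable: separating variables in the ODE
gives the bounded antiderivative `2 arctan √(2r/π - 1)`. Hence the action `∫ ρ(s, γ s) ds` is
nonpositive and uniformly continuous in the supremum norm. These facts, recorded in
`IsTamePotential`, are all that the rest uses about `ρ_m`.

Replace the rescaled bridge by its polygonal interpolation over `2 ^ N` equal cells. Gaussian
increment tails and dyadic chaining (`measure_oscillation_le`) make the probability of a noticeable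
change in the action at most `exp (-l M)`, for any prescribed `M` once `N` and then `l` are large
(`exists_measure_polygonalAction_le`). For fixed `N` the increments are an affine image of a
standard Gaussian vector `z` (`map_increments`), so what remains is a finite-dimensional Laplace
asymptotic with rate `|z|²/2 - F z` (`eventually_integral_exp_le`, `eventually_le_integral_exp`).

The rate is compared with the energy by orthogonal projection. Fixing the sum of the increments
discards the component of `z` along `(1, …, 1)` and adds a uniform drift, so the kinetic energy of
the polygon is at most `|z|²/2 + x²/(2t)`, with equality when `z` has zero sum. Polygons are
admissible paths (`minEnergy_sub_le`), and conversely interpolating an `H¹` path does not raise its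
kinetic energy (`exists_bridgeIncrements_eq`). The bridge expectation therefore decays at rate
`minEnergy - x²/(2t)`, and the heat kernel supplies the missing `x²/(2t)`. -/

namespace WeakNoise

/-! ### The optimal profile -/

namespace IsOptimalProfile

variable {r : ℝ → ℝ}

theorem continuousOn_Ico (hr : IsOptimalProfile r) : ContinuousOn r (Set.Ico 1 2) :=
  hr.contDiffOn.continuousOn

theorem eq_reflect (hr : IsOptimalProfile r) {s : ℝ} (hs : s ∈ Set.Ioo (0 : ℝ) 2) :
    r s = r (1 + |s - 1|) := by
  rcases lt_or_ge s 1 with h | h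
  · rw [hr.symm s ⟨hs.1, h⟩, abs_of_neg (by linarith)]
    congr 1; ring
  · rw [abs_of_nonneg (by linarith)]
    congr 1; ring

theorem continuousOn (hr : IsOptimalProfile r) : ContinuousOn r (Set.Ioo 0 2) := by
  have h : ContinuousOn (fun s => r (1 + |s - 1|)) (Set.Ioo 0 2) := by
    refine hr.continuousOn_Ico.comp (by fun_prop) fun s hs => ?_
    have : |s - 1| < 1 := abs_lt.2 ⟨by linarith [hs.1], by linarith [hs.2]⟩
    exact ⟨by linarith [abs_nonneg (s - 1)], by linarith⟩
  exact h.congr fun s hs => hr.eq_reflect hs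

theorem pi_div_two_le (hr : IsOptimalProfile r) {s : ℝ} (hs : s ∈ Set.Ioo (0 : ℝ) 2) :
    Real.pi / 2 ≤ r s := by
  rw [hr.eq_reflect hs]
  have h1 : |s - 1| < 1 := abs_lt.2 ⟨by linarith [hs.1], by linarith [hs.2]⟩
  rcases (abs_nonneg (s - 1)).eq_or_lt with h | h
  · rw [← h, add_zero, hr.init]
  · exact (hr.gt _ ⟨by linarith, by linarith⟩).le

theorem pos (hr : IsOptimalProfile r) {s : ℝ} (hs : s ∈ Set.Ioo (0 : ℝ) 2) : 0 < r s :=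
  lt_of_lt_of_le (by positivity) (hr.pi_div_two_le hs)

/-- With `q² = 2r/π - 1`, separation of variables turns `r dt` into `2 dq / (1 + q²)`. The
antiderivative is bounded even where `r` is not, which yields the integrability of `r`. -/
theorem hasDerivAt_arctan (hr : IsOptimalProfile r) {s : ℝ} (hs : s ∈ Set.Ioo (1 : ℝ) 2) :
    HasDerivAt (fun s => 2 * Real.arctan √(2 / Real.pi * r s - 1)) (r s) s := by
  have hpi := Real.pi_pos
  have hgt := hr.gt s hs
  have h0 : 0 < r s := lt_trans (by positivity) hgt
  have hw : 0 < 2 / Real.pi * r s - 1 := by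
    rw [div_mul_eq_mul_div, sub_pos, lt_div_iff₀ hpi]; linarith
  have h1 := ((((hr.ode s hs).const_mul (2 / Real.pi)).sub_const 1).sqrt hw.ne').arctan.const_mul 2
  refine h1.congr_deriv ?_
  have e : r s - Real.pi / 2 = Real.pi / 2 * (2 / Real.pi * r s - 1) := by field_simp
  rw [e, Real.sqrt_mul (by positivity), Real.sqrt_div hpi.le, Real.sq_sqrt hw.le]
  have a1 : √Real.pi ≠ 0 := (Real.sqrt_pos.2 hpi).ne'
  have a2 : √(2 : ℝ) ≠ 0 := by positivity
  have a3 : √(2 / Real.pi * r s - 1) ≠ 0 := (Real.sqrt_pos.2 hw).ne'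
  have a4 : 1 + (2 / Real.pi * r s - 1) = 2 / Real.pi * r s := by ring
  rw [a4]
  generalize √(2 / Real.pi * r s - 1) = q at a3 ⊢
  field_simp

theorem integrableOn_Ioc_of_lt (hr : IsOptimalProfile r) {T : ℝ} (h2 : T < 2) :
    IntegrableOn r (Set.Ioc 1 T) := by
  refine ((hr.continuousOn_Ico.mono ?_).integrableOn_Icc).mono_set Set.Ioc_subset_Icc_self
  exact fun s hs => ⟨hs.1, lt_of_le_of_lt hs.2 h2⟩

theorem integral_le_pi (hr : IsOptimalProfile r) {T : ℝ} (h1 : 1 ≤ T) (h2 : T < 2) :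
    ∫ s in (1 : ℝ)..T, r s ≤ Real.pi := by
  have hsub : Set.Icc 1 T ⊆ Set.Ico (1 : ℝ) 2 := fun s hs => ⟨hs.1, lt_of_le_of_lt hs.2 h2⟩
  have hc : ContinuousOn (fun s => 2 * Real.arctan √(2 / Real.pi * r s - 1)) (Set.Icc 1 T) := by
    have := hr.continuousOn_Ico.mono hsub
    exact continuousOn_const.mul (Real.continuous_arctan.comp_continuousOn
      (((continuousOn_const.mul this).sub continuousOn_const).sqrt))
  rw [intervalIntegral.integral_eq_sub_of_hasDerivAt_of_le h1 hc
    (fun s hs => hr.hasDerivAt_arctan ⟨hs.1, hs.2.trans h2⟩)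
    ((intervalIntegrable_iff_integrableOn_Ioc_of_le h1).2 (hr.integrableOn_Ioc_of_lt h2))]
  have a := Real.arctan_lt_pi_div_two √(2 / Real.pi * r T - 1)
  have b : 0 ≤ Real.arctan √(2 / Real.pi * r 1 - 1) :=
    Real.arctan_nonneg.2 (Real.sqrt_nonneg _)
  linarith

/-- Since `r` is positive, the bound `π` on its integrals over `[1, T]`, uniform in `T < 2`, passes
to the limit along `T = 2 - 1/(n+1)`. -/
theorem integrableOn_Ioo_one_two (hr : IsOptimalProfile r) : IntegrableOn r (Set.Ioo 1 2) := by
  have hb : ∀ n : ℕ, 1 ≤ 2 - 1 / ((n : ℝ) + 1) ∧ 2 - 1 / ((n : ℝ) + 1) < 2 := by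
    intro n
    have h1 : 0 < 1 / ((n : ℝ) + 1) := by positivity
    have h2 : 1 / ((n : ℝ) + 1) ≤ 1 := by
      rw [div_le_one (by positivity)]; linarith [Nat.cast_nonneg (α := ℝ) n]
    exact ⟨by linarith, by linarith⟩
  have key : IntegrableOn r (Set.Ioc 1 2) := by
    refine integrableOn_Ioc_of_intervalIntegral_norm_bounded_right (I := Real.pi)
      (b := fun n : ℕ => 2 - 1 / ((n : ℝ) + 1)) (l := atTop)
      (fun n => hr.integrableOn_Ioc_of_lt (hb n).2) ?_ (Eventually.of_forall fun n => ?_)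
    · simpa using (tendsto_const_nhds (x := (2 : ℝ))).sub
        (tendsto_one_div_add_atTop_nhds_zero_nat (𝕜 := ℝ))
    · rw [setIntegral_congr_fun measurableSet_Ioc (g := r),
        ← intervalIntegral.integral_of_le (hb n).1]
      · exact hr.integral_le_pi (hb n).1 (hb n).2
      · intro s hs
        exact Real.norm_of_nonneg
          (hr.pos ⟨by linarith [hs.1], lt_of_le_of_lt hs.2 (hb n).2⟩).le
  exact key.mono_set Set.Ioo_subset_Ioc_self

theorem intervalIntegrable (hr : IsOptimalProfile r) : IntervalIntegrable r volume 0 2 := by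
  have h1 : IntervalIntegrable r volume 1 2 :=
    (intervalIntegrable_iff_integrableOn_Ioo_of_le (by norm_num)).2 hr.integrableOn_Ioo_one_two
  have h2 : IntervalIntegrable (fun s => r (2 - s)) volume 0 1 := by
    have := (h1.comp_sub_left 2).symm
    norm_num at this
    exact this
  have h3 : IntervalIntegrable r volume 0 1 := by
    rw [intervalIntegrable_iff_integrableOn_Ioo_of_le (by norm_num)] at h2 ⊢
    exact h2.congr_fun (fun s hs => (hr.symm s hs).symm) measurableSet_Ioo
  exact h3.trans h1

end IsOptimalProfile

/-! ### Tame potentials -/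

/-- Potentials on `[0, t] × ℝ` which are nonpositive and whose integral along continuous paths
is bounded and uniformly continuous with respect to the supremum norm. -/
structure IsTamePotential (ρ : ℝ → ℝ → ℝ) (t : ℝ) : Prop where
  integrable : ∀ γ : ℝ → ℝ, ContinuousOn γ (Set.Icc 0 t) →
    IntervalIntegrable (fun s => ρ s (γ s)) volume 0 t
  nonpos : ∀ γ : ℝ → ℝ, ∫ s in (0 : ℝ)..t, ρ s (γ s) ≤ 0
  uniform : ∀ ε > 0, ∃ η > 0, ∀ γ γ' : ℝ → ℝ, ContinuousOn γ (Set.Icc 0 t) →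
    ContinuousOn γ' (Set.Icc 0 t) → (∀ s ∈ Set.Icc 0 t, |γ s - γ' s| ≤ η) →
    |(∫ s in (0 : ℝ)..t, ρ s (γ s)) - ∫ s in (0 : ℝ)..t, ρ s (γ' s)| ≤ ε

theorem abs_parabola_sub_le_two_mul (u v : ℝ) :
    |max (1 - u ^ 2) 0 - max (1 - v ^ 2) 0| ≤ 2 * |u - v| := by
  have key : ∀ u v : ℝ, max (1 - u ^ 2) 0 - max (1 - v ^ 2) 0 ≤ 2 * |u - v| := by
    intro u v
    have h1 : |v| - |u| ≤ |u - v| := by rw [abs_sub_comm]; exact abs_sub_abs_le_abs_sub v u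
    have h2 := le_max_left (1 - v ^ 2) 0
    have h3 := le_max_right (1 - v ^ 2) 0
    rw [← sq_abs v] at h2 h3 ⊢
    rw [← sq_abs u]
    have hu := abs_nonneg u
    have hv := abs_nonneg v
    have hd := abs_nonneg (u - v)
    rcases le_total (1 - |u| ^ 2) 0 with h | h
    · rw [max_eq_right h]; linarith
    · rw [max_eq_left h]
      have hu1 : |u| ≤ 1 := by nlinarith
      rcases le_total |v| 1 with h' | h'
      · nlinarith
      · nlinarith
  rw [abs_le]
  have := key v u
  rw [abs_sub_comm] at this
  exact ⟨by linarith, key u v⟩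

/-- Complements the Lipschitz bound. After scaling, that bound carries a factor `r²`, whose
integrability is not available; this one costs only a factor `r`. -/
theorem abs_parabola_sub_le_one (u v : ℝ) :
    |max (1 - u ^ 2) 0 - max (1 - v ^ 2) 0| ≤ 1 := by
  have key : ∀ u : ℝ, 0 ≤ max (1 - u ^ 2) 0 ∧ max (1 - u ^ 2) 0 ≤ 1 := fun u =>
    ⟨le_max_right _ _, max_le (by nlinarith) (by norm_num)⟩
  rw [abs_le]
  constructor <;> linarith [(key u).1, (key u).2, (key v).1, (key v).2]

/-- Without the quotient, continuity in `s` and the Lipschitz dependence on `y` are visible.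
Division by zero conventions make it hold even for `r s = 0`. -/
theorem optimalDeviation_eq (r : ℝ → ℝ) (s y : ℝ) :
    optimalDeviation r s y = -(r s / (2 * Real.pi)) * max (1 - (y * r s) ^ 2) 0 := by
  simp only [optimalDeviation, ell]
  congr 3
  rw [div_pow, one_pow, div_div_eq_mul_div, div_one, mul_pow]

theorem IsOptimalProfile.isTamePotential {r : ℝ → ℝ} (hr : IsOptimalProfile r) {t : ℝ}
    (ht : 0 < t) (ht2 : t ≤ 2) : IsTamePotential (optimalDeviation r) t := by
  have hpi := Real.pi_pos
  have hsub : Set.Ioo 0 t ⊆ Set.Ioo (0 : ℝ) 2 := Set.Ioo_subset_Ioo_right ht2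
  have hrt : IntervalIntegrable r volume 0 t :=
    hr.intervalIntegrable.mono_set (by
      rw [Set.uIcc_of_le ht.le, Set.uIcc_of_le (by norm_num)]
      exact Set.Icc_subset_Icc_right ht2)
  have hg : IntervalIntegrable (fun s => r s / (2 * Real.pi)) volume 0 t := hrt.div_const _
  have hgpos : ∀ s ∈ Set.Ioo 0 t, 0 ≤ r s / (2 * Real.pi) := fun s hs =>
    div_nonneg (hr.pos (hsub hs)).le (by positivity)
  have hrc : ContinuousOn r (Set.Ioo 0 t) := hr.continuousOn.mono hsub
  have hint : ∀ γ : ℝ → ℝ, ContinuousOn γ (Set.Icc 0 t) →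
      IntervalIntegrable (fun s => optimalDeviation r s (γ s)) volume 0 t := by
    intro γ hγ
    rw [intervalIntegrable_iff_integrableOn_Ioo_of_le ht.le] at hg ⊢
    refine Integrable.mono' hg ?_ ?_
    · refine ContinuousOn.aestronglyMeasurable ?_ measurableSet_Ioo
      have hγ' := hγ.mono Set.Ioo_subset_Icc_self
      simp only [optimalDeviation_eq]
      refine (hrc.div_const _).neg.mul (ContinuousOn.sup ?_ continuousOn_const)
      exact continuousOn_const.sub ((hγ'.mul hrc).pow 2)
    · refine (ae_restrict_mem measurableSet_Ioo).mono fun s hs => ?_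
      have h := hgpos s hs
      have h1 : max (1 - (γ s * r s) ^ 2) 0 ≤ 1 := max_le (by nlinarith [sq_nonneg (γ s * r s)])
        (by norm_num)
      have h2 : 0 ≤ max (1 - (γ s * r s) ^ 2) 0 := le_max_right _ _
      rw [optimalDeviation_eq, Real.norm_eq_abs, abs_mul, abs_neg, abs_of_nonneg h,
        abs_of_nonneg h2]
      nlinarith
  refine ⟨hint, ?_, ?_⟩
  -- No regularity of `γ` is needed: the integral of a nonintegrable function is `0` by convention.
  -- This makes the action nonpositive at every sample point, not just almost surely.
  · intro γ
    rw [intervalIntegral.integral_of_le ht.le, ← integral_Ioc_eq_integral_Ioo.symm]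
    refine setIntegral_nonpos measurableSet_Ioo fun s hs => ?_
    rw [optimalDeviation_eq, neg_mul, neg_nonpos]
    exact mul_nonneg (hgpos s hs) (le_max_right _ _)
  · intro ε hε
    -- `W η` dominates the change of the potential under a displacement of at most `η`. It is
    -- bounded by the integrable `r / 2π` and tends to `0` pointwise with `η`, so dominated
    -- convergence gives the modulus of continuity.
    set W : ℝ → ℝ → ℝ := fun η s => r s / (2 * Real.pi) * min 1 (2 * r s * η) with hW
    have hWm : ∀ η, AEStronglyMeasurable (W η) (volume.restrict (Set.Ioo 0 t)) := fun η =>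
      ContinuousOn.aestronglyMeasurable ((hrc.div_const _).mul (ContinuousOn.inf
        continuousOn_const ((continuousOn_const.mul hrc).mul continuousOn_const)))
        measurableSet_Ioo
    have hWb : ∀ η ≥ 0, ∀ s ∈ Set.Ioo 0 t, ‖W η s‖ ≤ r s / (2 * Real.pi) := by
      intro η hη s hs
      have h := hgpos s hs
      have h1 : 0 ≤ min 1 (2 * r s * η) :=
        le_min zero_le_one (by have := (hr.pos (hsub hs)).le; positivity)
      rw [Real.norm_eq_abs, abs_mul, abs_of_nonneg h, abs_of_nonneg h1]
      nlinarith [min_le_left 1 (2 * r s * η)]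
    have hWi : ∀ η ≥ 0, IntegrableOn (W η) (Set.Ioo 0 t) := fun η hη =>
      Integrable.mono' ((intervalIntegrable_iff_integrableOn_Ioo_of_le ht.le).1 hg) (hWm η)
        ((ae_restrict_mem measurableSet_Ioo).mono (hWb η hη))
    have hlim : Tendsto (fun η => ∫ s in Set.Ioo 0 t, W η s) (𝓝[>] 0) (𝓝 0) := by
      suffices h : Tendsto (fun η => ∫ s in Set.Ioo 0 t, W η s) (𝓝[>] 0)
          (𝓝 (∫ s in Set.Ioo 0 t, (0 : ℝ))) by simpa using h
      refine tendsto_integral_filter_of_dominated_convergence (fun s => r s / (2 * Real.pi))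
        (Eventually.of_forall hWm) ?_
        ((intervalIntegrable_iff_integrableOn_Ioo_of_le ht.le).1 hg) ?_
      · filter_upwards [self_mem_nhdsWithin] with η hη
        exact (ae_restrict_mem measurableSet_Ioo).mono (hWb η (le_of_lt hη))
      · refine Eventually.of_forall fun s => ?_
        have : Continuous fun η => W η s := by simp only [hW]; fun_prop
        have h0 : W 0 s = 0 := by simp [hW]
        have h2 := (this.tendsto 0).mono_left (nhdsWithin_le_nhds (s := Set.Ioi 0))
        rwa [h0] at h2
    obtain ⟨η, hη1, hη⟩ := ((hlim.eventually (gt_mem_nhds hε)).and self_mem_nhdsWithin).exists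
    refine ⟨η, hη, fun γ γ' hγ hγ' hclose => ?_⟩
    rw [← intervalIntegral.integral_sub (hint γ hγ) (hint γ' hγ'),
      intervalIntegral.integral_of_le ht.le, integral_Ioc_eq_integral_Ioo, ← Real.norm_eq_abs]
    refine (norm_integral_le_of_norm_le (hWi η (le_of_lt hη)) ?_).trans hη1.le
    refine (ae_restrict_mem measurableSet_Ioo).mono fun s hs => ?_
    have h := hgpos s hs
    have hrs := hr.pos (hsub hs)
    rw [optimalDeviation_eq, optimalDeviation_eq, ← mul_sub, Real.norm_eq_abs, abs_mul, abs_neg,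
      abs_of_nonneg h]
    refine mul_le_mul_of_nonneg_left (le_min (abs_parabola_sub_le_one _ _) ?_) h
    refine (abs_parabola_sub_le_two_mul _ _).trans ?_
    rw [← sub_mul, abs_mul, abs_of_pos hrs]
    nlinarith [hclose s (Set.Ioo_subset_Icc_self hs)]

/-! ### Polygonal paths -/

/-- The piecewise linear ramp from `0` to `1` on `[0, 1]`. -/
noncomputable def ramp (u : ℝ) : ℝ := max 0 (min u 1)

theorem ramp_of_nonpos {u : ℝ} (h : u ≤ 0) : ramp u = 0 :=
  max_eq_left ((min_le_left _ _).trans h)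

theorem ramp_of_one_le {u : ℝ} (h : 1 ≤ u) : ramp u = 1 := by
  rw [ramp, min_eq_right h, max_eq_right zero_le_one]

theorem ramp_of_mem {u : ℝ} (h0 : 0 ≤ u) (h1 : u ≤ 1) : ramp u = u := by
  rw [ramp, min_eq_left h1, max_eq_right h0]

theorem abs_ramp_le_one (u : ℝ) : |ramp u| ≤ 1 := by
  rw [abs_of_nonneg (le_max_left _ _)]
  exact max_le zero_le_one (min_le_right _ _)

theorem abs_ramp_sub_le (u v : ℝ) : |ramp u - ramp v| ≤ |u - v| := by
  have h1 := abs_max_sub_max_le_abs (min u 1) (min v 1) 0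
  have h2 := abs_min_sub_min_le_max u 1 v 1
  rw [sub_self, abs_zero, max_eq_left (abs_nonneg _)] at h2
  simp only [ramp, max_comm (0 : ℝ)]
  exact h1.trans h2

theorem hasDerivAt_ramp_of_neg {u : ℝ} (h : u < 0) : HasDerivAt ramp 0 u :=
  (hasDerivAt_const u (0 : ℝ)).congr_of_eventuallyEq
    ((gt_mem_nhds h).mono fun _ hv => ramp_of_nonpos (le_of_lt hv))

theorem hasDerivAt_ramp_of_one_lt {u : ℝ} (h : 1 < u) : HasDerivAt ramp 0 u :=
  (hasDerivAt_const u (1 : ℝ)).congr_of_eventuallyEq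
    ((lt_mem_nhds h).mono fun _ hv => ramp_of_one_le (le_of_lt hv))

theorem hasDerivAt_ramp_of_mem {u : ℝ} (h : u ∈ Set.Ioo (0 : ℝ) 1) : HasDerivAt ramp 1 u :=
  (hasDerivAt_id u).congr_of_eventuallyEq
    (Filter.Eventually.mono (Ioo_mem_nhds h.1 h.2) fun _ hv => ramp_of_mem hv.1.le hv.2.le)

/-- The `k`-th node of the division of `[0, t]` into `n` intervals of equal length. -/
noncomputable def node (t : ℝ) (n k : ℕ) : ℝ := k * t / n

/-- The increments of a function over the division of `[0, t]` into `n` intervals. -/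
noncomputable def increments (t : ℝ) (n : ℕ) (f : ℝ → ℝ) (i : Fin n) : ℝ :=
  f (node t n (i + 1)) - f (node t n i)

/-- The path which starts from `0` and is linear with increment `d i` on the `i`-th of `n`
intervals of equal length dividing `[0, t]`. -/
noncomputable def polygonal (t : ℝ) (n : ℕ) (d : Fin n → ℝ) (s : ℝ) : ℝ :=
  ∑ i, d i * ramp (n * s / t - (i : ℕ))

section

variable {t : ℝ} {n : ℕ}

theorem node_zero : node t n 0 = 0 := by simp [node]

theorem node_self (hn : 0 < n) : node t n n = t := by
  have : (n : ℝ) ≠ 0 := by positivity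
  simp only [node]; field_simp

theorem node_succ_sub (k : ℕ) : node t n (k + 1) - node t n k = t / n := by
  simp only [node]; push_cast; ring

theorem node_mono (ht : 0 < t) : Monotone (node t n) := by
  intro i j h
  simp only [node]
  gcongr

theorem node_mem (ht : 0 < t) (hn : 0 < n) {k : ℕ} (hk : k ≤ n) : node t n k ∈ Set.Icc 0 t := by
  constructor
  · simp only [node]; positivity
  · exact (node_mono ht hk).trans_eq (node_self hn)

theorem mul_div_mem_iff (ht : 0 < t) (hn : 0 < n) {s : ℝ} {k : ℕ} :
    s ∈ Set.Icc (node t n k) (node t n (k + 1)) ↔ n * s / t - k ∈ Set.Icc (0 : ℝ) 1 := by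
  have hn' : (0 : ℝ) < n := by positivity
  simp only [node, Set.mem_Icc, div_le_iff₀ hn', le_div_iff₀ hn', sub_nonneg, le_div_iff₀ ht,
    sub_le_iff_le_add, div_le_iff₀ ht]
  push_cast
  constructor <;> rintro ⟨h1, h2⟩ <;> constructor <;> nlinarith

theorem mul_div_mem_Ioo (ht : 0 < t) (hn : 0 < n) {s : ℝ} {k : ℕ}
    (h : s ∈ Set.Ioo (node t n k) (node t n (k + 1))) : n * s / t - k ∈ Set.Ioo (0 : ℝ) 1 := by
  have hn' : (0 : ℝ) < n := by positivity
  simp only [node, Set.mem_Ioo, div_lt_iff₀ hn', lt_div_iff₀ hn', sub_pos, lt_div_iff₀ ht,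
    sub_lt_iff_lt_add, div_lt_iff₀ ht] at h ⊢
  push_cast at h
  exact ⟨by linarith, by linarith⟩

theorem exists_cell (ht : 0 < t) (hn : 0 < n) {s : ℝ} (hs : s ∈ Set.Icc 0 t) :
    ∃ i < n, s ∈ Set.Icc (node t n i) (node t n (i + 1)) := by
  have hu0 : 0 ≤ n * s / t := by have := hs.1; positivity
  rcases eq_or_lt_of_le hs.2 with h | h
  -- At `s = t` the floor would give `n`, one past the last cell.
  · refine ⟨n - 1, by omega, ?_⟩
    rw [Nat.sub_add_cancel hn, node_self hn, h]
    exact ⟨(node_mem ht hn (Nat.sub_le n 1)).2, le_rfl⟩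
  · refine ⟨⌊n * s / t⌋₊, ?_, ?_⟩
    · rw [Nat.floor_lt hu0, div_lt_iff₀ ht]
      have hn' : (0 : ℝ) < n := by positivity
      nlinarith
    · rw [mul_div_mem_iff ht hn]
      exact ⟨by linarith [Nat.floor_le hu0], by linarith [Nat.lt_floor_add_one (n * s / t)]⟩

theorem polygonal_zero (d : Fin n → ℝ) : polygonal t n d 0 = 0 := by
  refine Finset.sum_eq_zero fun i _ => ?_
  rw [ramp_of_nonpos (by simp), mul_zero]

theorem polygonal_end (ht : 0 < t) (d : Fin n → ℝ) : polygonal t n d t = ∑ i, d i := by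
  refine Finset.sum_congr rfl fun i _ => ?_
  have : ((i : ℕ) : ℝ) + 1 ≤ n := by exact_mod_cast i.2
  rw [ramp_of_one_le, mul_one]
  rw [mul_div_assoc, div_self ht.ne']
  linarith

theorem abs_polygonal_sub_le (d d' : Fin n → ℝ) (s : ℝ) :
    |polygonal t n d s - polygonal t n d' s| ≤ ∑ i, |d i - d' i| := by
  rw [polygonal, polygonal, ← Finset.sum_sub_distrib]
  refine (Finset.abs_sum_le_sum_abs _ _).trans (Finset.sum_le_sum fun i _ => ?_)
  rw [← sub_mul, abs_mul]
  exact mul_le_of_le_one_right (abs_nonneg _) (abs_ramp_le_one _)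

theorem lipschitzWith_polygonal (ht : 0 < t) (d : Fin n → ℝ) :
    ∃ K, LipschitzWith K (polygonal t n d) := by
  refine ⟨NNReal.mk (∑ i, |d i| * (n / t)) (Finset.sum_nonneg fun i _ => by positivity),
    LipschitzWith.of_dist_le_mul fun s s' => ?_⟩
  rw [Real.dist_eq, Real.dist_eq, polygonal, polygonal, ← Finset.sum_sub_distrib, NNReal.coe_mk,
    Finset.sum_mul]
  refine (Finset.abs_sum_le_sum_abs _ _).trans (Finset.sum_le_sum fun i _ => ?_)
  rw [← mul_sub, abs_mul, mul_assoc]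
  refine mul_le_mul_of_nonneg_left ((abs_ramp_sub_le _ _).trans (le_of_eq ?_)) (abs_nonneg _)
  rw [← abs_of_nonneg (by positivity : 0 ≤ n / t), ← abs_mul]
  congr 1
  ring

theorem continuous_polygonal (ht : 0 < t) (d : Fin n → ℝ) : Continuous (polygonal t n d) :=
  (lipschitzWith_polygonal ht d).choose_spec.continuous

theorem hasDerivAt_polygonal (ht : 0 < t) (hn : 0 < n) (d : Fin n → ℝ) (i : Fin n) {s : ℝ}
    (hs : s ∈ Set.Ioo (node t n i) (node t n (i + 1))) :
    HasDerivAt (polygonal t n d) (d i * (n / t)) s := by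
  have hu := mul_div_mem_Ioo ht hn hs
  have key : ∀ j ∈ (Finset.univ : Finset (Fin n)),
      HasDerivAt (fun s => d j * ramp (n * s / t - (j : ℕ)))
        (if j = i then d i * (n / t) else 0) s := by
    intro j _
    have hlin : HasDerivAt (fun s : ℝ => n * s / t - (j : ℕ)) (n / t) s := by
      simpa using (((hasDerivAt_id s).const_mul (n : ℝ)).div_const t).sub_const ((j : ℕ) : ℝ)
    rcases lt_trichotomy j i with h | h | h
    · rw [if_neg h.ne]
      have h' : ((j : ℕ) : ℝ) + 1 ≤ (i : ℕ) := by exact_mod_cast h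
      have := ((hasDerivAt_ramp_of_one_lt (u := n * s / t - (j : ℕ)) (by linarith [hu.1])).comp s
        hlin).const_mul (d j)
      simpa using this
    · subst h
      rw [if_pos rfl]
      simpa using ((hasDerivAt_ramp_of_mem hu).comp s hlin).const_mul (d j)
    · rw [if_neg h.ne']
      have h' : ((i : ℕ) : ℝ) + 1 ≤ (j : ℕ) := by exact_mod_cast h
      have := ((hasDerivAt_ramp_of_neg (u := n * s / t - (j : ℕ)) (by linarith [hu.2])).comp s
        hlin).const_mul (d j)
      simpa using this
  have := HasDerivAt.fun_sum key
  rw [Finset.sum_ite_eq' Finset.univ i, if_pos (Finset.mem_univ i)] at this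
  exact this

theorem integral_eq_sum_cells (hn : 0 < n) (ht : 0 < t) {f : ℝ → ℝ}
    (hf : IntervalIntegrable f volume 0 t) :
    ∫ s in (0 : ℝ)..t, f s = ∑ i : Fin n, ∫ s in (node t n i)..(node t n (i + 1)), f s := by
  rw [Fin.sum_univ_eq_sum_range (fun k => ∫ s in (node t n k)..(node t n (k + 1)), f s),
    intervalIntegral.sum_integral_adjacent_intervals, node_zero, node_self hn]
  intro k hk
  refine hf.mono_set ?_
  rw [Set.uIcc_of_le (node_mono ht (Nat.le_succ k)), Set.uIcc_of_le ht.le]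
  exact Set.Icc_subset_Icc (node_mem ht hn hk.le).1 (node_mem ht hn hk).2

theorem memLp_deriv_polygonal (ht : 0 < t) (d : Fin n → ℝ) :
    MemLp (deriv (polygonal t n d)) 2 (volume.restrict (Set.Icc 0 t)) := by
  obtain ⟨K, hK⟩ := lipschitzWith_polygonal ht d
  exact MemLp.of_bound (measurable_deriv _).aestronglyMeasurable K
    (Eventually.of_forall fun s => norm_deriv_le_of_lipschitz hK)

theorem intervalIntegrable_deriv_sq (ht : 0 < t) {γ : ℝ → ℝ}
    (h : MemLp (deriv γ) 2 (volume.restrict (Set.Icc 0 t))) :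
    IntervalIntegrable (fun s => deriv γ s ^ 2) volume 0 t := by
  rw [intervalIntegrable_iff_integrableOn_Icc_of_le ht.le]
  exact h.integrable_sq

theorem polygonal_mem_H1Path (ht : 0 < t) (d : Fin n → ℝ) :
    polygonal t n d ∈ H1Path t (∑ i, d i) := by
  obtain ⟨K, hK⟩ := lipschitzWith_polygonal ht d
  exact ⟨(hK.lipschitzOnWith (s := Set.uIcc 0 t)).absolutelyContinuousOnInterval,
    memLp_deriv_polygonal ht d, polygonal_zero d, polygonal_end ht d⟩

theorem integral_deriv_polygonal_sq (ht : 0 < t) (hn : 0 < n) (d : Fin n → ℝ) :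
    ∫ s in (0 : ℝ)..t, deriv (polygonal t n d) s ^ 2 = n / t * ∑ i, d i ^ 2 := by
  rw [integral_eq_sum_cells hn ht (intervalIntegrable_deriv_sq ht (memLp_deriv_polygonal ht d)),
    Finset.mul_sum]
  refine Finset.sum_congr rfl fun i _ => ?_
  have hle : node t n i ≤ node t n (i + 1) := node_mono ht (Nat.le_succ _)
  have hn' : (n : ℝ) ≠ 0 := by positivity
  -- Pass to open cells: the derivative is known only away from the nodes, which are null.
  rw [intervalIntegral.integral_of_le hle, integral_Ioc_eq_integral_Ioo,
    setIntegral_congr_fun measurableSet_Ioo (g := fun _ => (d i * (n / t)) ^ 2)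
      (fun s hs => by simp only [(hasDerivAt_polygonal ht hn d i hs).deriv]),
    ← integral_Ioc_eq_integral_Ioo, ← intervalIntegral.integral_of_le hle,
    intervalIntegral.integral_const, node_succ_sub, smul_eq_mul]
  field_simp

/-- Cauchy–Schwarz on each cell, in the form `∫ (γ' - c)² ≥ 0` with `c` the mean slope. Thus
interpolation does not increase kinetic energy. -/
theorem sum_increments_sq_le (ht : 0 < t) (hn : 0 < n) {x : ℝ} {γ : ℝ → ℝ}
    (hγ : γ ∈ H1Path t x) :
    n / t * ∑ i, increments t n γ i ^ 2 ≤ ∫ s in (0 : ℝ)..t, deriv γ s ^ 2 := by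
  obtain ⟨hac, hL2, -, -⟩ := hγ
  have hsq := intervalIntegrable_deriv_sq ht hL2
  have hn' : (0 : ℝ) < n := by positivity
  rw [integral_eq_sum_cells hn ht hsq, Finset.mul_sum]
  refine Finset.sum_le_sum fun i _ => ?_
  have hle : node t n i ≤ node t n (i + 1) := node_mono ht (Nat.le_succ _)
  have hsub : Set.uIcc (node t n i) (node t n (i + 1)) ⊆ Set.uIcc 0 t := by
    rw [Set.uIcc_of_le hle, Set.uIcc_of_le ht.le]
    exact Set.Icc_subset_Icc (node_mem ht hn i.2.le).1 (node_mem ht hn i.2).2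
  have hac' := hac.mono hsub
  have hsq' := hsq.mono_set hsub
  set c := increments t n γ i * (n / t) with hc
  have hint : ∫ s in (node t n i)..(node t n (i + 1)), deriv γ s = increments t n γ i :=
    hac'.integral_deriv_eq_sub
  have hpos : 0 ≤ ∫ s in (node t n i)..(node t n (i + 1)), (deriv γ s - c) ^ 2 :=
    intervalIntegral.integral_nonneg hle fun _ _ => sq_nonneg _
  have hexp : ∀ s, (deriv γ s - c) ^ 2 = deriv γ s ^ 2 - 2 * c * deriv γ s + c ^ 2 :=
    fun s => by ring
  have hlin := hac'.intervalIntegrable_deriv.const_mul (2 * c)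
  simp only [hexp] at hpos
  rw [intervalIntegral.integral_add (hsq'.sub hlin) intervalIntegrable_const,
    intervalIntegral.integral_sub hsq' hlin, intervalIntegral.integral_const_mul, hint,
    intervalIntegral.integral_const, node_succ_sub, smul_eq_mul] at hpos
  have e : 2 * c * increments t n γ i - t / n * c ^ 2 = n / t * increments t n γ i ^ 2 := by
    rw [hc]; field_simp; ring
  linarith

/-- On the `i`-th cell the earlier ramps have saturated at `1`, so their increments telescope, and
the later ramps still vanish. -/
theorem polygonal_increments_eq (ht : 0 < t) (hn : 0 < n) (f : ℝ → ℝ) {i : ℕ} (hi : i < n) {s : ℝ}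
    (hs : s ∈ Set.Icc (node t n i) (node t n (i + 1))) :
    polygonal t n (increments t n f) s = f (node t n i) - f 0 +
      (f (node t n (i + 1)) - f (node t n i)) * (n * s / t - i) := by
  have hu := (mul_div_mem_iff ht hn).1 hs
  set u := n * s / t with hu'
  set g : ℕ → ℝ := fun k => f (node t n (k + 1)) - f (node t n k) with hg
  have h1 : ∀ m, m ≤ i → ∑ j ∈ Finset.range m, g j * ramp (u - j) = f (node t n m) - f 0 := by
    intro m hm
    have : ∀ j ∈ Finset.range m, g j * ramp (u - j) = g j := by
      intro j hj
      have : (j : ℝ) + 1 ≤ i := by exact_mod_cast (Finset.mem_range.1 hj).trans_le hm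
      rw [ramp_of_one_le (by linarith [hu.1]), mul_one]
    rw [Finset.sum_congr rfl this, hg, Finset.sum_range_sub (fun k => f (node t n k)), node_zero]
  have h2 : ∀ m, i + 1 ≤ m → ∑ j ∈ Finset.range m, g j * ramp (u - j)
      = f (node t n i) - f 0 + g i * (u - i) := by
    intro m hm
    induction m, hm using Nat.le_induction with
    | base => rw [Finset.sum_range_succ, h1 i le_rfl, ramp_of_mem hu.1 hu.2]
    | succ m hm ih =>
      have : (i : ℝ) + 1 ≤ m := by exact_mod_cast hm
      rw [Finset.sum_range_succ, ih, ramp_of_nonpos (by linarith [hu.2]), mul_zero, add_zero]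
  rw [← h2 n hi]
  exact Fin.sum_univ_eq_sum_range (fun k => g k * ramp (u - k)) n

/-- Both the interpolant and `f` stay within `η` of the value at the left node, hence the factor
`2`. -/
theorem abs_polygonal_increments_sub_le (ht : 0 < t) (hn : 0 < n) {f : ℝ → ℝ} (hf : f 0 = 0)
    {η : ℝ} (h : ∀ i < n, ∀ s ∈ Set.Icc (node t n i) (node t n (i + 1)),
      |f s - f (node t n i)| ≤ η) {s : ℝ} (hs : s ∈ Set.Icc 0 t) :
    |polygonal t n (increments t n f) s - f s| ≤ 2 * η := by
  obtain ⟨i, hi, hsi⟩ := exists_cell ht hn hs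
  have hu := (mul_div_mem_iff ht hn).1 hsi
  rw [polygonal_increments_eq ht hn f hi hsi, hf]
  have h1 := h i hi s hsi
  have h2 := h i hi _ (Set.right_mem_Icc.2 (node_mono ht (Nat.le_succ i)))
  have h3 : |(f (node t n (i + 1)) - f (node t n i)) * (n * s / t - i)| ≤ η := by
    rw [abs_mul, abs_of_nonneg hu.1]
    exact (mul_le_of_le_one_right (abs_nonneg _) hu.2).trans h2
  rw [abs_le] at h1 h3 ⊢
  constructor <;> linarith

/-- Continuous functions are uniformly approximated by their polygonal interpolations. -/
theorem exists_forall_abs_polygonal_increments_sub_le (ht : 0 < t) {f : ℝ → ℝ}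
    (hc : ContinuousOn f (Set.Icc 0 t)) (hf : f 0 = 0) {η : ℝ} (hη : 0 < η) :
    ∃ n₀ > 0, ∀ n ≥ n₀, ∀ s ∈ Set.Icc 0 t,
      |polygonal t n (increments t n f) s - f s| ≤ η := by
  have huc := isCompact_Icc.uniformContinuousOn_of_continuous hc
  obtain ⟨δ, hδ, h⟩ := Metric.uniformContinuousOn_iff.1 huc (η / 2) (by positivity)
  obtain ⟨m, hm⟩ := exists_nat_gt (t / δ)
  refine ⟨m + 1, by omega, fun n hn s hs => ?_⟩
  have hn0 : 0 < n := by omega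
  have hn' : (0 : ℝ) < n := by positivity
  have : (m : ℝ) + 1 ≤ n := by exact_mod_cast hn
  have htn : t / n < δ := by
    rw [div_lt_iff₀ hn']
    rw [div_lt_iff₀ hδ] at hm
    nlinarith
  have := abs_polygonal_increments_sub_le ht hn0 hf (η := η / 2) (fun i hi u hu => ?_) hs
  · linarith
  · have h0 := node_mem ht hn0 hi.le
    have h1 := node_mem ht hn0 (Nat.succ_le_of_lt hi)
    rw [← Real.dist_eq]
    refine (h u ⟨h0.1.trans hu.1, hu.2.trans h1.2⟩ _ h0 ?_).le
    rw [Real.dist_eq, abs_of_nonneg (by linarith [hu.1])]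
    linarith [hu.2, node_succ_sub (t := t) (n := n) i]

end

/-! ### Gaussian tails and increments of the Brownian bridge -/

/-- Allowing a proxy `v` above the variance lets bridge increments, of variance `(u - s) - (u -
s)²/t`, be treated with the simpler `u - s`. -/
theorem hasSubgaussianMGF_sub_integral {Ω : Type*} [MeasurableSpace Ω] {P : Measure Ω} {X : Ω → ℝ}
    (hX : HasGaussianLaw X P) {v : NNReal} (hv : Var[X; P] ≤ v) :
    HasSubgaussianMGF (fun ω => X ω - ∫ ω, X ω ∂P) v P := by
  have hlaw : HasLaw X (gaussianReal (∫ ω, X ω ∂P) Var[X; P].toNNReal) P :=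
    ⟨hX.aemeasurable, hX.map_eq_gaussianReal⟩
  have h0 := gaussianReal_sub_const hlaw (∫ ω, X ω ∂P)
  rw [sub_self] at h0
  have hmap := h0.map_eq
  refine ⟨fun s => ?_, fun s => ?_⟩
  · have := integrable_exp_mul_gaussianReal (μ := 0) (v := Var[X; P].toNNReal) s
    rw [← hmap] at this
    exact this.comp_aemeasurable h0.aemeasurable
  · rw [mgf_gaussianReal hmap, zero_mul, zero_add]
    have : (Var[X; P].toNNReal : ℝ) ≤ v := by
      rw [Real.coe_toNNReal _ (variance_nonneg _ _)]; exact hv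
    gcongr

theorem measureReal_lt_abs_sub_integral_le {Ω : Type*} [MeasurableSpace Ω] {P : Measure Ω}
    {X : Ω → ℝ} (hX : HasGaussianLaw X P) {v : NNReal} (hv : Var[X; P] ≤ v) {a : ℝ} (ha : 0 ≤ a) :
    P {ω | a < |X ω - ∫ ω, X ω ∂P|} ≤ ENNReal.ofReal (2 * Real.exp (-a ^ 2 / (2 * v))) := by
  have := hX.isProbabilityMeasure
  have h := hasSubgaussianMGF_sub_integral hX hv
  have h1 := h.measure_ge_le ha
  have h2 := h.neg.measure_ge_le ha
  rw [ENNReal.le_ofReal_iff_toReal_le (measure_ne_top _ _) (by positivity)]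
  refine (measureReal_mono (s₂ := {ω | a ≤ X ω - ∫ ω, X ω ∂P} ∪
    {ω | a ≤ (-fun ω => X ω - ∫ ω, X ω ∂P) ω}) fun ω hω => ?_).trans
    ((measureReal_union_le _ _).trans (by linarith))
  simp only [Set.mem_union, Set.mem_ofPred_eq, Pi.neg_apply] at hω ⊢
  rcases lt_abs.1 hω with h | h
  · exact Or.inl h.le
  · exact Or.inr h.le

namespace IsBrownianBridge

variable {Ω : Type*} [MeasurableSpace Ω] {t y : ℝ} {b : ℝ → Ω → ℝ} {P : Measure Ω}

theorem isProbabilityMeasure (hb : IsBrownianBridge t y b P) : IsProbabilityMeasure P :=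
  hb.gaussian.isProbabilityMeasure

theorem hasGaussianLaw (hb : IsBrownianBridge t y b P) {s : ℝ} (hs : s ∈ Set.Icc 0 t) :
    HasGaussianLaw (b s) P :=
  hb.gaussian.hasGaussianLaw_eval ⟨s, hs⟩

theorem memLp (hb : IsBrownianBridge t y b P) {s : ℝ} (hs : s ∈ Set.Icc 0 t) :
    MemLp (b s) 2 P :=
  (hb.hasGaussianLaw hs).memLp_two

theorem hasGaussianLaw_sub (hb : IsBrownianBridge t y b P) {s u : ℝ} (hs : s ∈ Set.Icc 0 t)
    (hu : u ∈ Set.Icc 0 t) : HasGaussianLaw (fun ω => b u ω - b s ω) P :=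
  hb.gaussian.hasGaussianLaw_fun_sub (s := ⟨u, hu⟩) (t := ⟨s, hs⟩)

theorem integral_sub (hb : IsBrownianBridge t y b P) {s u : ℝ} (hs : s ∈ Set.Icc 0 t)
    (hu : u ∈ Set.Icc 0 t) : ∫ ω, (b u ω - b s ω) ∂P = (u - s) / t * y := by
  have := hb.isProbabilityMeasure
  rw [MeasureTheory.integral_sub ((hb.memLp hu).integrable one_le_two)
    ((hb.memLp hs).integrable one_le_two), hb.mean u hu, hb.mean s hs]
  ring

theorem covariance_sub_self (hb : IsBrownianBridge t y b P) (ht : 0 < t) {s u : ℝ}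
    (hs : s ∈ Set.Icc 0 t) (hu : u ∈ Set.Icc 0 t) (hsu : s ≤ u) :
    cov[fun ω => b u ω - b s ω, fun ω => b u ω - b s ω; P] = (u - s) - (u - s) ^ 2 / t := by
  have := hb.isProbabilityMeasure
  rw [covariance_fun_sub_fun_sub (hb.memLp hu) (hb.memLp hs) (hb.memLp hu) (hb.memLp hs),
    covariance_comm (b u) (b s), hb.covariance u hu u hu le_rfl, hb.covariance s hs s hs le_rfl,
    hb.covariance s hs u hu hsu]
  field_simp
  ring

theorem covariance_sub_sub (hb : IsBrownianBridge t y b P) (ht : 0 < t) {s u s' u' : ℝ}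
    (hs : s ∈ Set.Icc 0 t) (hu : u ∈ Set.Icc 0 t) (hs' : s' ∈ Set.Icc 0 t)
    (hu' : u' ∈ Set.Icc 0 t) (hsu : s ≤ u) (hus : u ≤ s') (hsu' : s' ≤ u') :
    cov[fun ω => b u ω - b s ω, fun ω => b u' ω - b s' ω; P] = -((u - s) * (u' - s')) / t := by
  have := hb.isProbabilityMeasure
  rw [covariance_fun_sub_fun_sub (hb.memLp hu) (hb.memLp hs) (hb.memLp hu') (hb.memLp hs'),
    hb.covariance u hu u' hu' (by linarith), hb.covariance u hu s' hs' hus,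
    hb.covariance s hs u' hu' (by linarith), hb.covariance s hs s' hs' (by linarith)]
  field_simp
  ring

theorem ae_zero (hb : IsBrownianBridge t y b P) (ht : 0 < t) : ∀ᵐ ω ∂P, b 0 ω = 0 := by
  have := hb.isProbabilityMeasure
  have h0 : (0 : ℝ) ∈ Set.Icc 0 t := ⟨le_rfl, ht.le⟩
  have hv : Var[b 0; P] = 0 := by
    rw [← covariance_self (hb.hasGaussianLaw h0).aemeasurable, hb.covariance 0 h0 0 h0 le_rfl]
    simp
  have := ae_eq_integral_of_variance_eq_zero (hb.memLp h0) hv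
  rw [hb.mean 0 h0] at this
  simpa using this

theorem measure_increment_le (hb : IsBrownianBridge t y b P) (ht : 0 < t) {s u : ℝ}
    (hs : s ∈ Set.Icc 0 t) (hu : u ∈ Set.Icc 0 t) (hsu : s < u) {a : ℝ} (ha : 0 ≤ a) :
    P {ω | a < |b u ω - b s ω - (u - s) / t * y|} ≤
      ENNReal.ofReal (2 * Real.exp (-a ^ 2 / (2 * (u - s)))) := by
  have hG := hb.hasGaussianLaw_sub hs hu
  have hv : Var[fun ω => b u ω - b s ω; P] ≤ (NNReal.mk (u - s) (by linarith) : ℝ) := by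
    rw [← covariance_self hG.aemeasurable, hb.covariance_sub_self ht hs hu hsu.le, NNReal.coe_mk]
    have : 0 ≤ (u - s) ^ 2 / t := by positivity
    linarith
  have := measureReal_lt_abs_sub_integral_le hG hv ha
  rwa [hb.integral_sub hs hu, NNReal.coe_mk] at this

end IsBrownianBridge

/-! ### Dyadic chaining -/

theorem node_two_mul (t : ℝ) (m k : ℕ) : node t (2 ^ (m + 1)) (2 * k) = node t (2 ^ m) k := by
  simp only [node]
  push_cast
  rw [pow_succ]
  field_simp

/-- Chaining: an even node of one generation is a node of the previous one, and an odd node is one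
increment away from its even left neighbour. Each generation thus costs at most one increment; the
term `c 0` covers the right endpoint of the initial cell. -/
theorem abs_sub_dyadic_le {t : ℝ} {N : ℕ} {f : ℝ → ℝ} {c : ℕ → ℝ}
    (h : ∀ j, ∀ i < 2 ^ (N + j),
      |f (node t (2 ^ (N + j)) (i + 1)) - f (node t (2 ^ (N + j)) i)| ≤ c j)
    {i : ℕ} (hi : i < 2 ^ N) (J k : ℕ) (h1 : i * 2 ^ J ≤ k) (h2 : k ≤ (i + 1) * 2 ^ J) :
    |f (node t (2 ^ (N + J)) k) - f (node t (2 ^ N) i)| ≤ ∑ j ∈ Finset.range (J + 1), c j := by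
  have hc : ∀ j, 0 ≤ c j := fun j => (abs_nonneg _).trans (h j 0 (by positivity))
  induction J generalizing k with
  | zero =>
    have : k = i ∨ k = i + 1 := by omega
    rcases this with rfl | rfl
    · simpa using hc 0
    · simpa using h 0 i hi
  | succ J ih =>
    rw [Finset.sum_range_succ]
    rw [pow_succ] at h1 h2
    obtain ⟨m, rfl | rfl⟩ := Nat.even_or_odd' k
    · rw [← add_assoc, node_two_mul]
      have := ih m (by nlinarith) (by nlinarith)
      linarith [hc (J + 1)]
    · have hm1 : i * 2 ^ J ≤ m := by
        have : 2 * (i * 2 ^ J) ≤ 2 * m + 1 := by linarith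
        omega
      have hm2 : m + 1 ≤ (i + 1) * 2 ^ J := by
        have : 2 * m + 1 ≤ 2 * ((i + 1) * 2 ^ J) := by linarith
        omega
      have e1 := ih m hm1 (by omega)
      have hlt : 2 * m < 2 ^ (N + (J + 1)) := by
        have : (i + 1) * 2 ^ J ≤ 2 ^ N * 2 ^ J := Nat.mul_le_mul_right _ hi
        rw [← add_assoc, pow_succ, pow_add]
        omega
      have e2 := h (J + 1) (2 * m) hlt
      have e3 : node t (2 ^ (N + (J + 1))) (2 * m) = node t (2 ^ (N + J)) m := by
        rw [← add_assoc, node_two_mul]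
      rw [e3] at e2
      calc _ ≤ |f (node t (2 ^ (N + (J + 1))) (2 * m + 1)) - f (node t (2 ^ (N + J)) m)| +
            |f (node t (2 ^ (N + J)) m) - f (node t (2 ^ N) i)| := abs_sub_le _ _ _
        _ ≤ _ := by linarith

theorem abs_sub_node_le_of_dyadic {t : ℝ} (ht : 0 < t) {N : ℕ} {f : ℝ → ℝ}
    (hf : ContinuousOn f (Set.Icc 0 t)) {c : ℕ → ℝ} {η : ℝ}
    (hc : ∀ J, ∑ j ∈ Finset.range J, c j ≤ η)
    (h : ∀ j, ∀ i < 2 ^ (N + j),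
      |f (node t (2 ^ (N + j)) (i + 1)) - f (node t (2 ^ (N + j)) i)| ≤ c j)
    {i : ℕ} (hi : i < 2 ^ N) {s : ℝ} (hs : s ∈ Set.Icc (node t (2 ^ N) i) (node t (2 ^ N) (i + 1))) :
    |f s - f (node t (2 ^ N) i)| ≤ η := by
  have hs0 : s ∈ Set.Icc 0 t :=
    ⟨(node_mem ht (by positivity) hi.le).1.trans hs.1,
      hs.2.trans (node_mem ht (by positivity) (Nat.succ_le_of_lt hi)).2⟩
  -- Dyadic points of the same cell that converge to `s`; continuity carries the chaining bound to
  -- the limit.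
  set k : ℕ → ℕ := fun J => ⌊(2 : ℝ) ^ (N + J) * s / t⌋₊ with hk
  have hpos : ∀ J, 0 ≤ (2 : ℝ) ^ (N + J) * s / t := fun J => by have := hs0.1; positivity
  have hu := (mul_div_mem_iff ht (by positivity)).1 hs
  push_cast at hu
  have e : ∀ J, (2 : ℝ) ^ (N + J) * s / t = 2 ^ N * s / t * 2 ^ J := fun J => by
    rw [pow_add]; ring
  have hk1 : ∀ J, i * 2 ^ J ≤ k J := fun J => by
    refine Nat.le_floor ?_
    push_cast
    rw [e J]
    exact mul_le_mul_of_nonneg_right (by linarith [hu.1]) (by positivity)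
  have hk2 : ∀ J, k J ≤ (i + 1) * 2 ^ J := fun J => by
    refine Nat.floor_le_of_le ?_
    push_cast
    rw [e J]
    exact mul_le_mul_of_nonneg_right (by linarith [hu.2]) (by positivity)
  have hkn : ∀ J, k J ≤ 2 ^ (N + J) := fun J => by
    refine (hk2 J).trans ?_
    rw [pow_add]
    exact Nat.mul_le_mul_right _ hi
  have hclose : ∀ J, |node t (2 ^ (N + J)) (k J) - s| ≤ t * (1 / 2) ^ J := fun J => by
    have h1 := Nat.floor_le (hpos J)
    have h2 := (Nat.lt_floor_add_one ((2 : ℝ) ^ (N + J) * s / t)).le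
    have hP : (0 : ℝ) < 2 ^ (N + J) := by positivity
    have e1 : s = (2 : ℝ) ^ (N + J) * s / t * (t / 2 ^ (N + J)) := by field_simp
    have e2 : node t (2 ^ (N + J)) (k J) = k J * (t / 2 ^ (N + J)) := by
      simp only [node]; push_cast; ring
    have e3 : t / 2 ^ (N + J) ≤ t * (1 / 2) ^ J := by
      rw [div_eq_mul_inv, ← inv_pow, ← one_div]
      refine mul_le_mul_of_nonneg_left ?_ ht.le
      exact pow_le_pow_of_le_one (by norm_num) (by norm_num) (Nat.le_add_left J N)
    have e4 : 0 < t / 2 ^ (N + J) := by positivity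
    rw [abs_le, e2]
    nth_rewrite 1 [e1]
    nth_rewrite 2 [e1]
    constructor <;> nlinarith
  have hlim : Tendsto (fun J => node t (2 ^ (N + J)) (k J)) atTop (𝓝 s) := by
    rw [tendsto_iff_dist_tendsto_zero]
    refine squeeze_zero (fun _ => dist_nonneg) hclose ?_
    simpa using (tendsto_pow_atTop_nhds_zero_of_lt_one (r := (1 / 2 : ℝ)) (by norm_num)
      (by norm_num)).const_mul t
  have hlim' : Tendsto (fun J => node t (2 ^ (N + J)) (k J)) atTop (𝓝[Set.Icc 0 t] s) :=
    tendsto_nhdsWithin_iff.2 ⟨hlim, Eventually.of_forall fun J =>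
      node_mem ht (by positivity) (hkn J)⟩
  have := (((hf s hs0).tendsto.comp hlim').sub_const (f (node t (2 ^ N) i))).abs
  exact le_of_tendsto this (Eventually.of_forall fun J =>
    (abs_sub_dyadic_le h hi J (k J) (hk1 J) (hk2 J)).trans (hc _))

/-- The probability that the rescaled Brownian bridge oscillates by more than `η`
on a dyadic interval of generation `N` is exponentially small. -/
theorem IsBrownianBridge.measure_oscillation_le {Ω : Type*} [MeasurableSpace Ω] {t x l : ℝ}
    {b : ℝ → Ω → ℝ} {P : Measure Ω} (hl : 0 < l) (hb : IsBrownianBridge t (√l * x) b P)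
    (ht : 0 < t) {η : ℝ} (hη : 0 < η) (N : ℕ) (hA : 16 ≤ η ^ 2 * l * 2 ^ N / (32 * t)) :
    P {ω | ¬ ∀ i < 2 ^ N, ∀ s ∈ Set.Icc (node t (2 ^ N) i) (node t (2 ^ N) (i + 1)),
      |(b s ω / √l - s / t * x) - (b (node t (2 ^ N) i) ω / √l - node t (2 ^ N) i / t * x)| ≤ η} ≤
      ENNReal.ofReal (2 ^ (N + 2) * Real.exp (-(η ^ 2 * l * 2 ^ N / (32 * t)))) := by
  set A := η ^ 2 * l * 2 ^ N / (32 * t) with hAdef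
  -- The thresholds sum to at most `η`. Since the increment variance halves with each generation,
  -- the Gaussian exponent grows by `(3/4)² · 2 = 9/8 > 1` per generation, starting from `A`.
  set c : ℕ → ℝ := fun j => η / 4 * (3 / 4) ^ j with hc
  have hsl : 0 < √l := Real.sqrt_pos.2 hl
  have hcsum : ∀ J, ∑ j ∈ Finset.range J, c j ≤ η := fun J => by
    rw [← Finset.mul_sum, geom_sum_eq (by norm_num)]
    have h : (0 : ℝ) < (3 / 4) ^ J := by positivity
    have e : η / 4 * (((3 / 4 : ℝ) ^ J - 1) / (3 / 4 - 1)) = η - η * (3 / 4) ^ J := by ring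
    rw [e]
    linarith [mul_pos hη h]
  set S : ℕ → ℕ → Set Ω := fun j i => {ω | √l * c j <
    |b (node t (2 ^ (N + j)) (i + 1)) ω - b (node t (2 ^ (N + j)) i) ω -
      (node t (2 ^ (N + j)) (i + 1) - node t (2 ^ (N + j)) i) / t * (√l * x)|} with hS
  have hSle : ∀ j, ∀ i < 2 ^ (N + j),
      P (S j i) ≤ ENNReal.ofReal (2 * Real.exp (-(A * (9 / 8) ^ j))) := by
    intro j i hi
    have hcj : 0 ≤ c j := by positivity
    refine (hb.measure_increment_le ht (node_mem ht (by positivity) hi.le)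
      (node_mem ht (by positivity) (Nat.succ_le_of_lt hi)) ?_ (by positivity)).trans ?_
    · have := node_succ_sub (t := t) (n := 2 ^ (N + j)) i
      have : 0 < t / ((2 ^ (N + j) : ℕ) : ℝ) := by positivity
      linarith
    · refine ENNReal.ofReal_le_ofReal (le_of_eq ?_)
      congr 2
      rw [node_succ_sub, mul_pow, Real.sq_sqrt hl.le, hAdef, hc]
      push_cast
      have e : ((9 : ℝ) / 8) ^ j = ((3 / 4) ^ j) ^ 2 * 2 ^ j := by
        rw [← pow_mul, mul_comm j 2, pow_mul, ← mul_pow]; norm_num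
      rw [e, pow_add]
      field_simp
      ring
  have hsub : {ω | ¬ ∀ i < 2 ^ N, ∀ s ∈ Set.Icc (node t (2 ^ N) i) (node t (2 ^ N) (i + 1)),
      |(b s ω / √l - s / t * x) - (b (node t (2 ^ N) i) ω / √l - node t (2 ^ N) i / t * x)| ≤ η} ⊆
      {ω | ¬ ContinuousOn (fun s => b s ω) (Set.Icc 0 t)} ∪
        ⋃ j, ⋃ i ∈ Finset.range (2 ^ (N + j)), S j i := by
    intro ω hω
    by_contra hcon
    simp only [Set.mem_union, Set.mem_iUnion, Finset.mem_range, not_or, not_exists,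
      Set.mem_ofPred_eq, not_not] at hcon
    obtain ⟨hcont, hsmall⟩ := hcon
    refine hω fun i hi s hs => ?_
    refine abs_sub_node_le_of_dyadic (f := fun s => b s ω / √l - s / t * x) ht
      ((hcont.div_const _).sub (by fun_prop)) hcsum (fun j i hi => ?_) hi hs
    have := hsmall j i hi
    simp only [hS, Set.mem_ofPred_eq, not_lt] at this
    rw [mul_comm (√l) (c j), ← div_le_iff₀ hsl, ← abs_of_pos hsl, ← abs_div, abs_of_pos hsl] at this
    refine le_of_eq_of_le (congrArg _ ?_) this
    field_simp
    ring
  have hnull : P {ω | ¬ ContinuousOn (fun s => b s ω) (Set.Icc 0 t)} = 0 := hb.continuous_paths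
  have hlevel : ∀ j, P (⋃ i ∈ Finset.range (2 ^ (N + j)), S j i) ≤
      ENNReal.ofReal (2 ^ (N + 1) * Real.exp (-A) * (1 / 2) ^ j) := by
    intro j
    refine (measure_biUnion_finset_le _ _).trans ?_
    refine (Finset.sum_le_sum fun i hi => hSle j i (Finset.mem_range.1 hi)).trans ?_
    rw [Finset.sum_const, Finset.card_range, ← ENNReal.ofReal_nsmul]
    refine ENNReal.ofReal_le_ofReal ?_
    rw [nsmul_eq_mul]
    push_cast
    -- Bernoulli with `A ≥ 16` gives `A (9/8)^j ≥ A + 2j`. As `exp (-2) ≤ 1/4`, this beats the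
    -- `2^(N+j)` cells of generation `j` and leaves a geometric series of ratio `1/2`.
    have h1 : 1 + (j : ℝ) * (1 / 8) ≤ (9 / 8) ^ j := by
      have := one_add_mul_le_pow (a := (1 / 8 : ℝ)) (by norm_num) j
      norm_num at this ⊢
      exact this
    have h2 : Real.exp (-(A * (9 / 8) ^ j)) ≤ Real.exp (-A) * (1 / 4) ^ j := by
      have h3 : Real.exp (-2) ≤ 1 / 4 := by
        have : Real.exp (-2) = (Real.exp 1 ^ 2)⁻¹ := by
          rw [← Real.exp_nat_mul, ← Real.exp_neg]; norm_num
        rw [this, one_div]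
        have := Real.exp_one_gt_d9
        exact inv_anti₀ (by norm_num) (by nlinarith)
      calc Real.exp (-(A * (9 / 8) ^ j)) ≤ Real.exp (-A + j * (-2)) := by
            refine Real.exp_le_exp.2 ?_
            have := mul_le_mul_of_nonneg_left h1 (by linarith : 0 ≤ A)
            have h4 : (16 : ℝ) * j ≤ A * j := mul_le_mul_of_nonneg_right hA (Nat.cast_nonneg j)
            nlinarith
        _ = Real.exp (-A) * Real.exp (-2) ^ j := by rw [Real.exp_add, ← Real.exp_nat_mul]
        _ ≤ _ := by gcongr
    calc (2 : ℝ) ^ (N + j) * (2 * Real.exp (-(A * (9 / 8) ^ j)))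
        ≤ 2 ^ (N + j) * (2 * (Real.exp (-A) * (1 / 4) ^ j)) := by gcongr
      _ = 2 ^ (N + 1) * Real.exp (-A) * (1 / 2) ^ j := by
        have : (1 / 2 : ℝ) ^ j = 2 ^ j * (1 / 4) ^ j := by rw [← mul_pow]; norm_num
        rw [this, pow_add, pow_succ]; ring
  refine (measure_mono hsub).trans ((measure_union_le _ _).trans ?_)
  rw [hnull, zero_add]
  refine (measure_iUnion_le _).trans ((ENNReal.tsum_le_tsum hlevel).trans ?_)
  have hs : Summable fun j : ℕ => 2 ^ (N + 1) * Real.exp (-A) * (1 / 2 : ℝ) ^ j :=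
    (summable_geometric_of_lt_one (by norm_num) (by norm_num)).mul_left _
  rw [← ENNReal.ofReal_tsum_of_nonneg (fun j => by positivity) hs, tsum_mul_left,
    tsum_geometric_of_lt_one (by norm_num) (by norm_num)]
  refine ENNReal.ofReal_le_ofReal (le_of_eq ?_)
  rw [pow_succ 2 (N + 1)]
  ring

/-! ### The law of the increments of the bridge -/

theorem _root_.ContinuousLinearMap.apply_eq_sum_single {ι : Type*} [Fintype ι] [DecidableEq ι]
    (L : (ι → ℝ) →L[ℝ] ℝ) (v : ι → ℝ) : L v = ∑ i, L (Pi.single i 1) * v i := by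
  conv_lhs => rw [pi_eq_sum_univ' v, map_sum]
  refine Finset.sum_congr rfl fun i _ => ?_
  rw [map_smul, smul_eq_mul, mul_comm]

/-- The law of a Gaussian vector is determined by its mean and its covariance matrix. -/
theorem _root_.ProbabilityTheory.HasGaussianLaw.map_eq_map_of_covariance_eq
    {ι Ω Ω' : Type*} [Fintype ι] [MeasurableSpace Ω] [MeasurableSpace Ω'] {P : Measure Ω}
    {Q : Measure Ω'} {X : ι → Ω → ℝ} {Y : ι → Ω' → ℝ}
    (hX : HasGaussianLaw (fun ω i => X i ω) P) (hY : HasGaussianLaw (fun ω i => Y i ω) Q)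
    (hmean : ∀ i, ∫ ω, X i ω ∂P = ∫ ω, Y i ω ∂Q)
    (hcov : ∀ i j, cov[X i, X j; P] = cov[Y i, Y j; Q]) :
    P.map (fun ω i => X i ω) = Q.map (fun ω i => Y i ω) := by
  classical
  have := hX.isProbabilityMeasure
  have := hY.isProbabilityMeasure
  have hX2 : ∀ i, MemLp (X i) 2 P := fun i => (hX.eval i).memLp_two
  have hY2 : ∀ i, MemLp (Y i) 2 Q := fun i => (hY.eval i).memLp_two
  refine Measure.ext_of_charFunDual (funext fun L => ?_)
  rw [hX.charFunDual_map_eq_fun, hY.charFunDual_map_eq_fun]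
  -- The characteristic function at `L` involves only the mean and variance of `L`, which in
  -- coordinates are expressions in the given means and covariances.
  obtain ⟨a, ha⟩ : ∃ a : ι → ℝ, ∀ v, L v = ∑ i, a i * v i := ⟨_, L.apply_eq_sum_single⟩
  simp only [ha]
  rw [integral_finsetSum _ fun i _ => ((hX2 i).integrable one_le_two).const_mul _,
    integral_finsetSum _ fun i _ => ((hY2 i).integrable one_le_two).const_mul _,
    variance_fun_sum fun i => (hX2 i).const_mul _, variance_fun_sum fun i => (hY2 i).const_mul _]
  simp only [integral_const_mul, covariance_const_mul_left, covariance_const_mul_right, hmean, hcov]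

/-- The standard Gaussian measure on `ℝⁿ`. -/
noncomputable abbrev stdPi (n : ℕ) : Measure (Fin n → ℝ) := Measure.pi fun _ => gaussianReal 0 1

theorem hasLaw_eval_stdPi (n : ℕ) (i : Fin n) :
    HasLaw (fun z : Fin n → ℝ => z i) (gaussianReal 0 1) (stdPi n) :=
  ⟨(measurable_pi_apply i).aemeasurable, (measurePreserving_eval _ i).map_eq⟩

theorem memLp_eval_stdPi (n : ℕ) (i : Fin n) :
    MemLp (fun z : Fin n → ℝ => z i) 2 (stdPi n) :=
  (hasLaw_eval_stdPi n i).hasGaussianLaw.memLp_two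

theorem hasGaussianLaw_stdPi (n : ℕ) :
    HasGaussianLaw (fun (z : Fin n → ℝ) (i : Fin n) => z i) (stdPi n) :=
  iIndepFun.hasGaussianLaw (fun i => (hasLaw_eval_stdPi n i).hasGaussianLaw)
    (iIndepFun_pi (X := fun _ u => u) fun _ => aemeasurable_id)

theorem integral_eval_stdPi (n : ℕ) (i : Fin n) : ∫ z, z i ∂(stdPi n) = 0 := by
  rw [(hasLaw_eval_stdPi n i).integral_eq, integral_id_gaussianReal]

theorem covariance_eval_stdPi (n : ℕ) (i j : Fin n) :
    cov[fun z : Fin n → ℝ => z i, fun z => z j; stdPi n] = if i = j then 1 else 0 := by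
  split_ifs with h
  · subst h
    rw [covariance_self (hasLaw_eval_stdPi n i).aemeasurable, (hasLaw_eval_stdPi n i).variance_eq,
      variance_id_gaussianReal]
    simp
  · exact ((iIndepFun_pi (X := fun _ u => u) fun _ => aemeasurable_id).indepFun
      h).covariance_eq_zero (memLp_eval_stdPi n i) (memLp_eval_stdPi n j)

/-- The projection of `z`, up to scaling, to the increments of paths from `0` to `y` on `[0, t]`. -/
noncomputable def bridgeIncrements (t y : ℝ) (n : ℕ) (z : Fin n → ℝ) (i : Fin n) : ℝ :=
  √(t / n) * (z i - (∑ j, z j) / n) + y / n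

theorem continuous_bridgeIncrements (t y : ℝ) (n : ℕ) : Continuous (bridgeIncrements t y n) := by
  unfold bridgeIncrements
  fun_prop

theorem hasGaussianLaw_bridgeIncrements (t y : ℝ) (n : ℕ) :
    HasGaussianLaw (fun z i => bridgeIncrements t y n z i) (stdPi n) := by
  let L : (Fin n → ℝ) →L[ℝ] (Fin n → ℝ) := ContinuousLinearMap.pi fun i =>
    √(t / n) • (ContinuousLinearMap.proj i - (n : ℝ)⁻¹ • ∑ j, ContinuousLinearMap.proj j)
  have h := (hasGaussianLaw_stdPi n).map_fun L
  have h2 := h.isGaussian_map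
  refine ⟨?_⟩
  have e : (fun z i => bridgeIncrements t y n z i) =
      (fun v => v + fun _ : Fin n => y / n) ∘ fun z => L z := by
    ext z i
    simp [bridgeIncrements, L, div_eq_inv_mul]
  rw [e, ← Measure.map_map (by fun_prop) (by fun_prop)]
  infer_instance

theorem covariance_bridgeIncrements {t : ℝ} (ht : 0 < t) (y : ℝ) {n : ℕ} (hn : 0 < n)
    (i j : Fin n) :
    cov[fun z => bridgeIncrements t y n z i, fun z => bridgeIncrements t y n z j; stdPi n] =
      t / n * ((if i = j then 1 else 0) - 1 / n) := by
  have hn' : (n : ℝ) ≠ 0 := by positivity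
  have hm := memLp_eval_stdPi n
  have hs : MemLp (fun z : Fin n → ℝ => (∑ j, z j) / n) 2 (stdPi n) := by
    simp only [div_eq_mul_inv]
    exact (memLp_finsetSum Finset.univ fun j _ => hm j).mul_const _
  have hd : ∀ k, MemLp (fun z : Fin n → ℝ => z k - (∑ j, z j) / n) 2 (stdPi n) :=
    fun k => (hm k).sub hs
  simp only [bridgeIncrements]
  rw [covariance_add_const_left (((hd i).integrable one_le_two).const_mul _),
    covariance_add_const_right (((hd j).integrable one_le_two).const_mul _),
    covariance_const_mul_left, covariance_const_mul_right,
    covariance_fun_sub_fun_sub (hm i) hs (hm j) hs, covariance_fun_div_right,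
    covariance_fun_div_left, covariance_fun_div_left, covariance_fun_div_right,
    covariance_fun_sum_right (fun k => hm k) (hm i), covariance_fun_sum_left (fun k => hm k) (hm j),
    covariance_fun_sum_fun_sum (fun k => hm k) (fun k => hm k)]
  simp only [covariance_eval_stdPi, Finset.sum_ite_eq, Finset.sum_ite_eq', Finset.mem_univ, if_true,
    Finset.sum_const, Finset.card_univ, Fintype.card_fin, nsmul_eq_mul, mul_one]
  rw [← mul_assoc, Real.mul_self_sqrt (by positivity)]
  field_simp
  ring

theorem integral_bridgeIncrements (t y : ℝ) (n : ℕ) (i : Fin n) :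
    ∫ z, bridgeIncrements t y n z i ∂(stdPi n) = y / n := by
  have hi : ∀ k, Integrable (fun z : Fin n → ℝ => z k) (stdPi n) := fun k =>
    (memLp_eval_stdPi n k).integrable one_le_two
  have hs : Integrable (fun z : Fin n → ℝ => (∑ j, z j) / n) (stdPi n) :=
    (integrable_finsetSum _ fun j _ => hi j).div_const _
  simp only [bridgeIncrements]
  have hd : Integrable (fun z : Fin n → ℝ => √(t / n) * (z i - (∑ j, z j) / n)) (stdPi n) :=
    ((hi i).sub hs).const_mul _
  rw [integral_add hd (integrable_const _), integral_const_mul,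
    integral_sub (hi i) hs, integral_div, integral_finsetSum _ fun j _ => hi j]
  simp [integral_eval_stdPi]

/-- Both vectors are Gaussian with means `y/n` and covariances `t/n (δᵢⱼ - 1/n)`. -/
theorem IsBrownianBridge.map_increments {Ω : Type*} [MeasurableSpace Ω] {t y : ℝ}
    {b : ℝ → Ω → ℝ} {P : Measure Ω} (hb : IsBrownianBridge t y b P) (ht : 0 < t) {n : ℕ}
    (hn : 0 < n) :
    HasLaw (fun ω => increments t n (fun s => b s ω)) ((stdPi n).map (bridgeIncrements t y n))
      P := by
  have hmem : ∀ k : Fin (n + 1), node t n k ∈ Set.Icc 0 t := fun k =>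
    node_mem ht hn (Nat.lt_succ_iff.1 k.2)
  have hG : HasGaussianLaw (fun ω (i : Fin n) => b (node t n (i + 1)) ω - b (node t n i) ω) P :=
    hb.gaussian.hasGaussianLaw_increments (t := fun k : Fin (n + 1) => ⟨node t n k, hmem k⟩)
  refine ⟨hG.aemeasurable, ?_⟩
  have hn' : (n : ℝ) ≠ 0 := by positivity
  refine HasGaussianLaw.map_eq_map_of_covariance_eq
    (X := fun (i : Fin n) ω => b (node t n (i + 1)) ω - b (node t n i) ω)
    (Y := fun i z => bridgeIncrements t y n z i) hG (hasGaussianLaw_bridgeIncrements t y n)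
    (fun i => ?_) fun i j => ?_
  · refine (hb.integral_sub (hmem i.castSucc) (hmem i.succ)).trans ?_
    rw [integral_bridgeIncrements]
    simp only [Fin.val_castSucc, Fin.val_succ, node_succ_sub]
    field_simp
  · rw [covariance_bridgeIncrements ht y hn]
    have hle : ∀ k : Fin n, node t n k ≤ node t n (k + 1) := fun k => node_mono ht (Nat.le_succ _)
    have hlt : ∀ i j : Fin n, i < j →
        cov[fun ω => b (node t n (i + 1)) ω - b (node t n i) ω,
          fun ω => b (node t n (j + 1)) ω - b (node t n j) ω; P] = t / n * (0 - 1 / n) := by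
      intro i j hij
      have h := hb.covariance_sub_sub ht (hmem i.castSucc) (hmem i.succ) (hmem j.castSucc)
        (hmem j.succ) (hle i) (node_mono ht (Nat.succ_le_of_lt hij)) (hle j)
      simp only [Fin.val_castSucc, Fin.val_succ, node_succ_sub] at h
      rw [h]
      field_simp
      ring
    rcases lt_trichotomy i j with h | h | h
    · rw [hlt i j h, if_neg h.ne]
    · subst h
      have h := hb.covariance_sub_self ht (hmem i.castSucc) (hmem i.succ) (hle i)
      simp only [Fin.val_castSucc, Fin.val_succ, node_succ_sub] at h
      rw [h, if_pos rfl]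
      field_simp
    · rw [covariance_comm, hlt j i h, if_neg h.ne']

/-! ### Laplace asymptotics for finite-dimensional Gaussian measures -/

theorem eventually_le_exp_mul (K : ℝ) {δ : ℝ} (hδ : 0 < δ) :
    ∀ᶠ l : ℝ in atTop, K ≤ Real.exp (l * δ) :=
  (Real.tendsto_exp_atTop.comp (tendsto_id.atTop_mul_const hδ)).eventually_ge_atTop K

theorem integrable_exp_mul_sq_gaussianReal {θ : ℝ} (hθ : θ < 1) :
    Integrable (fun u => Real.exp (θ * u ^ 2 / 2)) (gaussianReal 0 1) := by
  rw [gaussianReal_of_var_ne_zero _ one_ne_zero,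
    integrable_withDensity_iff_integrable_smul₀' (by fun_prop)
      (Eventually.of_forall fun _ => gaussianPDF_lt_top)]
  have h := (integrable_exp_neg_mul_sq (b := (1 - θ) / 2) (by linarith)).const_mul
    (√(2 * Real.pi))⁻¹
  refine h.congr (Eventually.of_forall fun u => ?_)
  simp only [toReal_gaussianPDF, gaussianPDFReal, smul_eq_mul, NNReal.coe_one, mul_one, sub_zero]
  rw [mul_assoc, ← Real.exp_add]
  congr 2
  ring

theorem integrable_exp_mul_sum_sq_stdPi (n : ℕ) {θ : ℝ} (hθ : θ < 1) :
    Integrable (fun z : Fin n → ℝ => Real.exp (θ * (∑ i, z i ^ 2) / 2)) (stdPi n) := by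
  have h := Integrable.fintype_prod (μ := fun _ : Fin n => gaussianReal 0 1)
    (f := fun _ u => Real.exp (θ * u ^ 2 / 2)) fun _ => integrable_exp_mul_sq_gaussianReal hθ
  refine h.congr (Eventually.of_forall fun z => ?_)
  simp only [← Real.exp_sum]
  rw [Finset.mul_sum, Finset.sum_div]

/-- The bound `F z ≤ |z|²/2 - m` would exactly cancel the Gaussian weight. As `F ≤ 0`, it may be
applied to `(1 - δ) F` instead, leaving a finite Gaussian moment independent of `l`; no compactness
is needed. -/
theorem eventually_integral_exp_le {n : ℕ} {F : (Fin n → ℝ) → ℝ} (hF : Continuous F)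
    (hF0 : ∀ z, F z ≤ 0) {m : ℝ} (hm : ∀ z, m ≤ (∑ i, z i ^ 2) / 2 - F z) {ε : ℝ} (hε : 0 < ε) :
    ∀ᶠ l : ℝ in atTop, ∫ z, Real.exp (l * F fun i => z i / √l) ∂(stdPi n) ≤
      Real.exp (-l * (m - ε)) := by
  -- Chosen so that replacing `m` by `(1 - δ) m` loses at most `ε/2`; the other `ε/2` absorbs the
  -- moment `K`.
  set δ := min 1 (ε / (2 * (|m| + 1))) with hδ
  have hδ0 : 0 < δ := lt_min one_pos (by positivity)
  have hδ1 : δ ≤ 1 := min_le_left _ _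
  have hδm : δ * m ≤ ε / 2 := by
    have h1 : δ * (|m| + 1) ≤ ε / 2 := by
      have := min_le_right 1 (ε / (2 * (|m| + 1)))
      calc δ * (|m| + 1) ≤ ε / (2 * (|m| + 1)) * (|m| + 1) := by gcongr
        _ = ε / 2 := by field_simp
    nlinarith [le_abs_self m]
  have hint := integrable_exp_mul_sum_sq_stdPi n (θ := 1 - δ) (by linarith)
  set K := ∫ z : Fin n → ℝ, Real.exp ((1 - δ) * (∑ i, z i ^ 2) / 2) ∂(stdPi n) with hK
  filter_upwards [eventually_le_exp_mul K (half_pos hε), eventually_gt_atTop 0] with l hl hl0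
  have hpt : ∀ z : Fin n → ℝ, Real.exp (l * F fun i => z i / √l) ≤
      Real.exp (-l * ((1 - δ) * m)) * Real.exp ((1 - δ) * (∑ i, z i ^ 2) / 2) := by
    intro z
    rw [← Real.exp_add]
    refine Real.exp_le_exp.2 ?_
    have h1 := hm fun i => z i / √l
    have h2 := hF0 fun i => z i / √l
    simp only [div_pow, Real.sq_sqrt hl0.le, ← Finset.sum_div] at h1
    set f := F fun i => z i / √l
    set S := ∑ i, z i ^ 2
    have h3 : f ≤ S / l / 2 - m := by linarith
    have h4 : l * f ≤ (1 - δ) * (l * f) := by nlinarith [mul_nonneg hδ0.le (mul_nonneg hl0.le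
      (neg_nonneg.2 h2))]
    have h5 : (1 - δ) * (l * f) ≤ (1 - δ) * (l * (S / l / 2 - m)) :=
      mul_le_mul_of_nonneg_left (mul_le_mul_of_nonneg_left h3 hl0.le) (by linarith)
    have h6 : (1 - δ) * (l * (S / l / 2 - m)) = -l * ((1 - δ) * m) + (1 - δ) * S / 2 := by
      field_simp
      ring
    linarith
  have hbd : Integrable (fun z : Fin n → ℝ => Real.exp (l * F fun i => z i / √l)) (stdPi n) := by
    refine Integrable.mono' (hint.const_mul (Real.exp (-l * ((1 - δ) * m)))) ?_ (Eventually.of_forall fun z => ?_)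
    · exact Continuous.aestronglyMeasurable (by fun_prop)
    · rw [Real.norm_of_nonneg (Real.exp_pos _).le]
      exact hpt z
  refine (integral_mono hbd (hint.const_mul _) hpt).trans ?_
  rw [integral_const_mul]
  calc _ ≤ Real.exp (-l * ((1 - δ) * m)) * Real.exp (l * (ε / 2)) := by gcongr
    _ ≤ _ := by
      rw [← Real.exp_add]
      refine Real.exp_le_exp.2 ?_
      nlinarith

theorem mul_exp_le_gaussianReal_Icc (u : ℝ) :
    (√(2 * Real.pi))⁻¹ * Real.exp (-(|u| + 1) ^ 2 / 2) ≤
      (gaussianReal 0 1).real (Set.Icc (u - 1) (u + 1)) := by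
  rw [measureReal_def, gaussianReal_apply_eq_integral _ one_ne_zero,
    ENNReal.toReal_ofReal (integral_nonneg fun _ => gaussianPDFReal_nonneg _ _ _)]
  have h1 : ∀ v ∈ Set.Icc (u - 1) (u + 1), (√(2 * Real.pi))⁻¹ * Real.exp (-(|u| + 1) ^ 2 / 2) ≤
      gaussianPDFReal 0 1 v := by
    intro v hv
    simp only [gaussianPDFReal, NNReal.coe_one, mul_one, sub_zero]
    have : |v| ≤ |u| + 1 := by
      have h2 : |v - u| ≤ 1 := abs_le.2 ⟨by linarith [hv.1], by linarith [hv.2]⟩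
      have h3 := abs_sub_abs_le_abs_sub v u
      linarith
    have h4 : v ^ 2 ≤ (|u| + 1) ^ 2 := by
      rw [← sq_abs v]
      exact pow_le_pow_left₀ (abs_nonneg v) this 2
    gcongr
  have h2 := setIntegral_mono_on (μ := volume) (integrableOn_const (by simp))
    (integrable_gaussianPDFReal 0 1).integrableOn measurableSet_Icc h1
  rw [setIntegral_const, Real.volume_real_Icc, smul_eq_mul] at h2
  refine le_trans ?_ h2
  have : max (u + 1 - (u - 1)) 0 = 2 := by
    rw [max_eq_left (by linarith)]; ring
  rw [this]
  have : 0 ≤ (√(2 * Real.pi))⁻¹ * Real.exp (-(|u| + 1) ^ 2 / 2) := by positivity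
  linarith

/-- Only a box of half-width `1` about `√l w` is kept. After division by `√l` it shrinks to `w`, so
`F` is nearly constant there, and its Gaussian mass is `exp (-l |w|²/2)` up to a factor `exp
(-O(√l))`. -/
theorem eventually_le_integral_exp {n : ℕ} {F : (Fin n → ℝ) → ℝ} (hF : Continuous F)
    (hF0 : ∀ z, F z ≤ 0) (w : Fin n → ℝ) {ε : ℝ} (hε : 0 < ε) :
    ∀ᶠ l : ℝ in atTop, Real.exp (-l * ((∑ i, w i ^ 2) / 2 - F w + ε)) ≤
      ∫ z, Real.exp (l * F fun i => z i / √l) ∂(stdPi n) := by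
  obtain ⟨δ, hδ, hFδ⟩ := Metric.continuous_iff.1 hF w (ε / 2) (by positivity)
  set c := (√(2 * Real.pi))⁻¹ with hc
  have hc0 : 0 < c := by positivity
  set S := ∑ i, |w i| with hS
  set C := (n : ℝ) / 2 - n * Real.log c with hC
  -- The three terms serve, in order, to absorb `√l S + C` into `l ε/2`, to have `√l ≥ 1`, and to
  -- bring the rescaled box within `δ` of `w`.
  have hlarge := Real.tendsto_sqrt_atTop.eventually_ge_atTop ((S + |C|) * (2 / ε) + 1 + 2 / δ)
  filter_upwards [hlarge, eventually_gt_atTop 0] with l hl hl0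
  have hS0 : 0 ≤ S := Finset.sum_nonneg fun i _ => abs_nonneg _
  have hSC : 0 ≤ (S + |C|) * (2 / ε) := by positivity
  have hδ2 : 0 < 2 / δ := by positivity
  have hsl : 0 < √l := Real.sqrt_pos.2 hl0
  have hsl1 : 1 ≤ √l := by linarith
  have hsq : √l ^ 2 = l := Real.sq_sqrt hl0.le
  have hexp : √l * S + C ≤ l * (ε / 2) := by
    have h1 : (S + |C|) * (2 / ε) ≤ √l := by linarith
    have h2 : S + |C| ≤ √l * (ε / 2) := by
      have := mul_le_mul_of_nonneg_right h1 (by positivity : 0 ≤ ε / 2)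
      calc S + |C| = (S + |C|) * (2 / ε) * (ε / 2) := by field_simp
        _ ≤ _ := this
    have h3 := mul_le_mul_of_nonneg_left h2 hsl.le
    have h4 : |C| ≤ √l * |C| := le_mul_of_one_le_left (abs_nonneg C) hsl1
    nlinarith [le_abs_self C]
  set B : Set (Fin n → ℝ) := Set.univ.pi fun i => Set.Icc (√l * w i - 1) (√l * w i + 1) with hB
  have hBm : MeasurableSet B := MeasurableSet.univ_pi fun i => measurableSet_Icc
  have hBmeas : Real.exp (-(l * (∑ i, w i ^ 2) / 2 + √l * S + C)) ≤ (stdPi n).real B := by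
    rw [hB, measureReal_def, Measure.pi_pi, ENNReal.toReal_prod]
    refine le_trans (le_of_eq ?_) (Finset.prod_le_prod (fun i _ => by positivity)
      fun i _ => mul_exp_le_gaussianReal_Icc (√l * w i))
    rw [Finset.prod_mul_distrib, ← Real.exp_sum, Finset.prod_const, Finset.card_univ,
      Fintype.card_fin, ← hc]
    nth_rewrite 1 [← Real.exp_log hc0]
    rw [← Real.exp_nat_mul, ← Real.exp_add]
    congr 1
    have e : ∀ i, -(|√l * w i| + 1) ^ 2 / 2 = -(l / 2) * w i ^ 2 - √l * |w i| - 1 / 2 := by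
      intro i
      rw [abs_mul, abs_of_pos hsl, ← sq_abs (w i), ← hsq, Real.sqrt_sq hsl.le]
      ring
    simp only [e, Finset.sum_sub_distrib, ← Finset.mul_sum, Finset.sum_const, Finset.card_univ,
      Fintype.card_fin, nsmul_eq_mul]
    rw [hC]
    ring
  have hpt : ∀ z ∈ B, Real.exp (l * (F w - ε / 2)) ≤ Real.exp (l * F fun i => z i / √l) := by
    intro z hz
    have hd : dist (fun i => z i / √l) w < δ := by
      refine (dist_pi_lt_iff hδ).2 fun i => ?_
      have hzi := hz i (Set.mem_univ i)
      have e : z i / √l - w i = (z i - √l * w i) / √l := by field_simp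
      rw [Real.dist_eq, e, abs_div, abs_of_pos hsl, div_lt_iff₀ hsl]
      have h1 : |z i - √l * w i| ≤ 1 := abs_le.2 ⟨by linarith [hzi.1], by linarith [hzi.2]⟩
      have h2 : 2 / δ ≤ √l := by linarith
      rw [div_le_iff₀ hδ] at h2
      linarith
    have := hFδ _ hd
    rw [Real.dist_eq] at this
    refine Real.exp_le_exp.2 (mul_le_mul_of_nonneg_left ?_ hl0.le)
    linarith [(abs_lt.1 this).1]
  have hbd : Integrable (fun z : Fin n → ℝ => Real.exp (l * F fun i => z i / √l)) (stdPi n) := by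
    refine Integrable.of_bound (C := 1) (Continuous.aestronglyMeasurable (by fun_prop))
      (Eventually.of_forall fun z => ?_)
    rw [Real.norm_of_nonneg (Real.exp_pos _).le]
    exact Real.exp_le_one_iff.2 (mul_nonpos_of_nonneg_of_nonpos hl0.le (hF0 _))
  calc Real.exp (-l * ((∑ i, w i ^ 2) / 2 - F w + ε))
      ≤ Real.exp (-(l * (∑ i, w i ^ 2) / 2 + √l * S + C)) * Real.exp (l * (F w - ε / 2)) := by
        rw [← Real.exp_add]
        refine Real.exp_le_exp.2 ?_
        linarith
    _ ≤ (stdPi n).real B * Real.exp (l * (F w - ε / 2)) := by gcongr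
    _ = ∫ z in B, Real.exp (l * (F w - ε / 2)) ∂(stdPi n) := by
        rw [setIntegral_const, smul_eq_mul]
    _ ≤ ∫ z in B, Real.exp (l * F fun i => z i / √l) ∂(stdPi n) :=
        setIntegral_mono_on (integrable_const _) hbd.integrableOn hBm hpt
    _ ≤ _ := setIntegral_le_integral hbd (Eventually.of_forall fun z => (Real.exp_pos _).le)

/-! ### The action of polygonal paths -/

theorem energy_eq {ρ : ℝ → ℝ → ℝ} {t x : ℝ} (ht : 0 < t) (hρ : IsTamePotential ρ t) {γ : ℝ → ℝ}
    (hγ : γ ∈ H1Path t x) :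
    energy ρ t γ = (∫ s in (0 : ℝ)..t, deriv γ s ^ 2) / 2 - ∫ s in (0 : ℝ)..t, ρ s (γ s) := by
  have hc : ContinuousOn γ (Set.Icc 0 t) := by
    have := hγ.1.continuousOn
    rwa [Set.uIcc_of_le ht.le] at this
  rw [energy, intervalIntegral.integral_sub
    ((intervalIntegrable_deriv_sq ht hγ.2.1).div_const 2) (hρ.integrable γ hc),
    intervalIntegral.integral_div]

theorem energy_nonneg {ρ : ℝ → ℝ → ℝ} {t x : ℝ} (ht : 0 < t) (hρ : IsTamePotential ρ t)
    {γ : ℝ → ℝ} (hγ : γ ∈ H1Path t x) : 0 ≤ energy ρ t γ := by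
  rw [energy_eq ht hρ hγ]
  have h1 : 0 ≤ ∫ s in (0 : ℝ)..t, deriv γ s ^ 2 :=
    intervalIntegral.integral_nonneg ht.le fun _ _ => sq_nonneg _
  linarith [hρ.nonpos γ]

theorem nonempty_H1Path {t : ℝ} (ht : 0 < t) (x : ℝ) : (H1Path t x).Nonempty :=
  ⟨polygonal t 1 fun _ => x, by simpa using polygonal_mem_H1Path ht fun _ : Fin 1 => x⟩

/-- The infimum of the energy over the paths from `0` to `x`. -/
noncomputable def minEnergy (ρ : ℝ → ℝ → ℝ) (t x : ℝ) : ℝ := sInf (energy ρ t '' H1Path t x)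

theorem bddBelow_energy {ρ : ℝ → ℝ → ℝ} {t : ℝ} (ht : 0 < t) (hρ : IsTamePotential ρ t) (x : ℝ) :
    BddBelow (energy ρ t '' H1Path t x) :=
  ⟨0, by rintro _ ⟨γ, hγ, rfl⟩; exact energy_nonneg ht hρ hγ⟩

theorem isGLB_minEnergy {ρ : ℝ → ℝ → ℝ} {t : ℝ} (ht : 0 < t) (hρ : IsTamePotential ρ t) (x : ℝ) :
    IsGLB (energy ρ t '' H1Path t x) (minEnergy ρ t x) :=
  isGLB_csInf ((nonempty_H1Path ht x).image _) (bddBelow_energy ht hρ x)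

/-- The integral of a potential along the polygonal path with increments `d`. -/
noncomputable def polygonalAction (ρ : ℝ → ℝ → ℝ) (t : ℝ) (n : ℕ) (d : Fin n → ℝ) : ℝ :=
  ∫ s in (0 : ℝ)..t, ρ s (polygonal t n d s)

theorem continuous_polygonalAction {ρ : ℝ → ℝ → ℝ} {t : ℝ} (ht : 0 < t) (hρ : IsTamePotential ρ t)
    (n : ℕ) : Continuous (polygonalAction ρ t n) := by
  refine Metric.continuous_iff.2 fun d ε hε => ?_
  obtain ⟨η, hη, h⟩ := hρ.uniform (ε / 2) (by positivity)
  refine ⟨η / (n + 1), by positivity, fun d' hd => ?_⟩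
  have := h _ _ (continuous_polygonal ht d').continuousOn (continuous_polygonal ht d).continuousOn
    fun s _ => ?_
  · rw [Real.dist_eq]
    exact this.trans_lt (by linarith)
  · refine (abs_polygonal_sub_le d' d s).trans ?_
    have h1 : ∀ i ∈ (Finset.univ : Finset (Fin n)), |d' i - d i| ≤ η / (n + 1) := fun i _ => by
      rw [← Real.dist_eq]
      exact (dist_le_pi_dist d' d i).trans hd.le
    refine (Finset.sum_le_sum h1).trans ?_
    rw [Finset.sum_const, Finset.card_univ, Fintype.card_fin, nsmul_eq_mul, mul_div_assoc', div_le_iff₀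
      (by positivity)]
    nlinarith

theorem sum_bridgeIncrements {t x : ℝ} {n : ℕ} (hn : 0 < n) (z : Fin n → ℝ) :
    ∑ i, bridgeIncrements t x n z i = x := by
  have hn' : (n : ℝ) ≠ 0 := by positivity
  simp only [bridgeIncrements, Finset.sum_add_distrib, ← Finset.mul_sum, Finset.sum_sub_distrib,
    Finset.sum_const, Finset.card_univ, Fintype.card_fin, nsmul_eq_mul]
  field_simp
  ring

/-- Pythagoras: the centred part of `z` is orthogonal to the constant drift, and the difference of
the two sides is `(∑ z)²/n`. -/
theorem sum_bridgeIncrements_sq_le {t x : ℝ} (ht : 0 < t) {n : ℕ} (hn : 0 < n) (z : Fin n → ℝ) :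
    n / t * ∑ i, bridgeIncrements t x n z i ^ 2 ≤ ∑ i, z i ^ 2 + x ^ 2 / t := by
  have hn' : (n : ℝ) ≠ 0 := by positivity
  have hsq : √(t / n) ^ 2 = t / n := Real.sq_sqrt (by positivity)
  set S := ∑ j, z j with hS
  have e : ∀ i, bridgeIncrements t x n z i ^ 2 = t / n * z i ^ 2 +
      (2 * √(t / n) * (x / n) - 2 * (t / n) * (S / n)) * z i +
      (t / n * (S / n) ^ 2 - 2 * √(t / n) * (x / n) * (S / n) + (x / n) ^ 2) := by
    intro i
    rw [bridgeIncrements, ← hS, add_sq, mul_pow, hsq]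
    ring
  simp only [e]
  rw [Finset.sum_add_distrib, Finset.sum_add_distrib, ← Finset.mul_sum, ← Finset.mul_sum,
    Finset.sum_const, Finset.card_univ, Fintype.card_fin, nsmul_eq_mul, ← hS]
  have e2 : n / t * (t / n * ∑ i, z i ^ 2 +
      (2 * √(t / n) * (x / n) - 2 * (t / n) * (S / n)) * S +
      n * (t / n * (S / n) ^ 2 - 2 * √(t / n) * (x / n) * (S / n) + (x / n) ^ 2)) =
      ∑ i, z i ^ 2 + x ^ 2 / t - S ^ 2 / n := by
    field_simp
    ring
  have : 0 ≤ S ^ 2 / n := by positivity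
  linarith

theorem minEnergy_sub_le {ρ : ℝ → ℝ → ℝ} {t : ℝ} (ht : 0 < t) (hρ : IsTamePotential ρ t) (x : ℝ)
    {n : ℕ} (hn : 0 < n) (z : Fin n → ℝ) :
    minEnergy ρ t x - x ^ 2 / (2 * t) ≤
      (∑ i, z i ^ 2) / 2 - polygonalAction ρ t n (bridgeIncrements t x n z) := by
  have hmem := polygonal_mem_H1Path ht (bridgeIncrements t x n z)
  rw [sum_bridgeIncrements hn] at hmem
  have h1 := csInf_le (bddBelow_energy ht hρ x) (Set.mem_image_of_mem _ hmem)
  rw [energy_eq ht hρ hmem, integral_deriv_polygonal_sq ht hn] at h1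
  have h2 := sum_bridgeIncrements_sq_le (x := x) ht hn z
  have e : x ^ 2 / (2 * t) = x ^ 2 / t / 2 := by field_simp
  rw [e]
  simp only [polygonalAction, minEnergy]
  linarith

/-- The normalized centred increments have zero sum, so the projection fixes them. Their squared
norm is the kinetic term of the increments minus `x²/t`. -/
theorem exists_bridgeIncrements_eq {t x : ℝ} (ht : 0 < t) {n : ℕ} (hn : 0 < n) {γ : ℝ → ℝ}
    (hγ : γ ∈ H1Path t x) :
    ∃ w, bridgeIncrements t x n w = increments t n γ ∧
      (∑ i, w i ^ 2) / 2 ≤ (∫ s in (0 : ℝ)..t, deriv γ s ^ 2) / 2 - x ^ 2 / (2 * t) := by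
  have hn' : (n : ℝ) ≠ 0 := by positivity
  have hsum : ∑ i, increments t n γ i = x := by
    have := Fin.sum_univ_eq_sum_range (fun k => γ (node t n (k + 1)) - γ (node t n k)) n
    rw [Finset.sum_range_sub (fun k => γ (node t n k)), node_zero, node_self hn, hγ.2.2.1,
      hγ.2.2.2, sub_zero] at this
    exact this
  have hprod : √(t / n) * √(n / t) = 1 := by
    rw [← Real.sqrt_mul (by positivity), div_mul_div_cancel₀ hn', div_self ht.ne', Real.sqrt_one]
  refine ⟨fun i => √(n / t) * (increments t n γ i - x / n), ?_, ?_⟩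
  · ext i
    rw [bridgeIncrements]
    simp only [← Finset.mul_sum, Finset.sum_sub_distrib, hsum, Finset.sum_const, Finset.card_univ,
      Fintype.card_fin, nsmul_eq_mul]
    rw [mul_div_cancel₀ _ hn', sub_self, mul_zero, zero_div, sub_zero, ← mul_assoc, hprod]
    ring
  · have h := sum_increments_sq_le ht hn hγ
    have e : ∀ i, (√(n / t) * (increments t n γ i - x / n)) ^ 2 =
        n / t * increments t n γ i ^ 2 - 2 * x / t * increments t n γ i + x ^ 2 / (n * t) := by
      intro i
      rw [mul_pow, Real.sq_sqrt (by positivity)]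
      field_simp
      ring
    simp only [e, Finset.sum_add_distrib, Finset.sum_sub_distrib, ← Finset.mul_sum, hsum,
      Finset.sum_const, Finset.card_univ, Fintype.card_fin, nsmul_eq_mul]
    have e2 : 2 * x / t * x - n * (x ^ 2 / (n * t)) = 2 * (x ^ 2 / (2 * t)) := by
      field_simp
      ring
    linarith

/-! ### The Feynman–Kac functional -/

theorem expFunctional_rescale {Ω : Type*} (l : ℝ) (ρ : ℝ → ℝ → ℝ) (t : ℝ) (b : ℝ → Ω → ℝ) (ω : Ω) :
    expFunctional (rescale l ρ) t b ω =
      Real.exp (l * ∫ s in (0 : ℝ)..t, ρ s (b s ω / √l)) := by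
  simp only [expFunctional, rescale, intervalIntegral.integral_const_mul]

theorem bridgeIncrements_div {t x l : ℝ} (hl : 0 < l) (n : ℕ) (z : Fin n → ℝ) :
    (fun i => bridgeIncrements t (√l * x) n z i / √l) =
      bridgeIncrements t x n fun i => z i / √l := by
  have hsl : √l ≠ 0 := (Real.sqrt_pos.2 hl).ne'
  ext i
  simp only [bridgeIncrements, ← Finset.sum_div]
  field_simp

theorem increments_div (t : ℝ) (n : ℕ) (f : ℝ → ℝ) (c : ℝ) :
    increments t n (fun s => f s / c) = fun i => increments t n f i / c := by
  ext i
  simp only [increments, sub_div]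

section

variable {Ω : Type*} [MeasurableSpace Ω] {t x l : ℝ} {b : ℝ → Ω → ℝ} {P : Measure Ω}
  {ρ : ℝ → ℝ → ℝ}

theorem IsBrownianBridge.aestronglyMeasurable_polygonalAction
    (hb : IsBrownianBridge t (√l * x) b P) (ht : 0 < t) (hρ : IsTamePotential ρ t) {n : ℕ}
    (hn : 0 < n) :
    AEStronglyMeasurable
      (fun ω => polygonalAction ρ t n (increments t n fun s => b s ω / √l)) P := by
  have hlaw := hb.map_increments ht hn
  have hc := continuous_polygonalAction ht hρ n
  simp only [increments_div]
  have : Continuous fun d : Fin n → ℝ => polygonalAction ρ t n fun i => d i / √l := by fun_prop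
  exact (this.measurable.comp_aemeasurable hlaw.aemeasurable).aestronglyMeasurable

theorem IsBrownianBridge.integral_exp_polygonalAction (hl : 0 < l)
    (hb : IsBrownianBridge t (√l * x) b P) (ht : 0 < t) (hρ : IsTamePotential ρ t) {n : ℕ}
    (hn : 0 < n) :
    ∫ ω, Real.exp (l * polygonalAction ρ t n (increments t n fun s => b s ω / √l)) ∂P =
      ∫ z, Real.exp (l * polygonalAction ρ t n (bridgeIncrements t x n fun i => z i / √l))
        ∂(stdPi n) := by
  have hlaw := hb.map_increments ht hn
  have hc := continuous_polygonalAction ht hρ n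
  simp only [increments_div, ← bridgeIncrements_div hl]
  have hcont : Continuous fun d : Fin n → ℝ =>
    Real.exp (l * polygonalAction ρ t n fun i => d i / √l) := by fun_prop
  have h := integral_map hlaw.aemeasurable
    (hcont.aestronglyMeasurable (μ := P.map fun ω => increments t n fun s => b s ω))
  rw [hlaw.map_eq, integral_map (continuous_bridgeIncrements _ _ _).aemeasurable
    hcont.aestronglyMeasurable] at h
  exact h.symm

/-- Joint measurability of `b` is not assumed. The action is instead an almost sure limit of
polygonal actions, each a continuous function of finitely many increments. -/
theorem IsBrownianBridge.aestronglyMeasurable_integral (hb : IsBrownianBridge t (√l * x) b P)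
    (ht : 0 < t) (hρ : IsTamePotential ρ t) :
    AEStronglyMeasurable (fun ω => ∫ s in (0 : ℝ)..t, ρ s (b s ω / √l)) P := by
  refine aestronglyMeasurable_of_tendsto_ae atTop
    (f := fun (k : ℕ) ω => polygonalAction ρ t (k + 1) (increments t (k + 1) fun s => b s ω / √l))
    (fun k => hb.aestronglyMeasurable_polygonalAction ht hρ k.succ_pos) ?_
  filter_upwards [hb.continuous_paths, hb.ae_zero ht] with ω hω h0
  refine Metric.tendsto_atTop.2 fun ε hε => ?_
  obtain ⟨η, hη, h⟩ := hρ.uniform (ε / 2) (by positivity)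
  obtain ⟨n₀, -, hn⟩ := exists_forall_abs_polygonal_increments_sub_le ht
    (f := fun s => b s ω / √l) (hω.div_const _) (by simp [h0]) hη
  refine ⟨n₀, fun k hk => ?_⟩
  have := h _ _ (continuous_polygonal ht _).continuousOn (hω.div_const _) (hn (k + 1) (by omega))
  rw [Real.dist_eq]
  exact this.trans_lt (by linarith)

theorem integrable_exp_mul_of_nonpos [IsProbabilityMeasure P] (hl : 0 < l) {U : Ω → ℝ}
    (hU : AEStronglyMeasurable U P) (hU0 : ∀ ω, U ω ≤ 0) :
    Integrable (fun ω => Real.exp (l * U ω)) P := by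
  refine Integrable.of_bound (C := 1) ?_ (Eventually.of_forall fun ω => ?_)
  · exact Real.continuous_exp.comp_aestronglyMeasurable (hU.const_mul l)
  · rw [Real.norm_of_nonneg (Real.exp_pos _).le]
    exact Real.exp_le_one_iff.2 (mul_nonpos_of_nonneg_of_nonpos hl.le (hU0 ω))

/-- On the exceptional event the integrand is at most `1`. The hypotheses are symmetric in `U` and
`V`, so the comparison serves both the upper and the lower bound. -/
theorem integral_exp_mul_le_of_measure_le [IsProbabilityMeasure P] (hl : 0 < l) {U V : Ω → ℝ}
    (hU : AEStronglyMeasurable U P) (hU0 : ∀ ω, U ω ≤ 0) (hV : AEStronglyMeasurable V P)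
    (hV0 : ∀ ω, V ω ≤ 0) {δ κ : ℝ} (hκ : 0 ≤ κ)
    (h : P {ω | ¬ |U ω - V ω| ≤ δ} ≤ ENNReal.ofReal κ) :
    ∫ ω, Real.exp (l * U ω) ∂P ≤ Real.exp (l * δ) * ∫ ω, Real.exp (l * V ω) ∂P + κ := by
  set S := toMeasurable P {ω | ¬ |U ω - V ω| ≤ δ} with hS
  have hSm : MeasurableSet S := measurableSet_toMeasurable _ _
  have hSP : P.real S ≤ κ := by
    rw [measureReal_def, hS, measure_toMeasurable]
    exact ENNReal.toReal_le_of_le_ofReal hκ h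
  have hiU := integrable_exp_mul_of_nonpos hl hU hU0
  have hiV := (integrable_exp_mul_of_nonpos hl hV hV0).const_mul (Real.exp (l * δ))
  have hiS : Integrable (S.indicator fun _ => (1 : ℝ)) P :=
    (integrable_const (1 : ℝ)).indicator hSm
  have hpt : ∀ ω, Real.exp (l * U ω) ≤
      Real.exp (l * δ) * Real.exp (l * V ω) + S.indicator (fun _ => (1 : ℝ)) ω := by
    intro ω
    by_cases hω : |U ω - V ω| ≤ δ
    · have h1 : Real.exp (l * U ω) ≤ Real.exp (l * δ) * Real.exp (l * V ω) := by
        rw [← Real.exp_add]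
        refine Real.exp_le_exp.2 ?_
        rw [← mul_add]
        exact mul_le_mul_of_nonneg_left (by linarith [(abs_le.1 hω).2]) hl.le
      have h2 : 0 ≤ S.indicator (fun _ => (1 : ℝ)) ω := Set.indicator_nonneg (by simp) ω
      linarith
    · have hmem : ω ∈ S := subset_toMeasurable _ _ hω
      rw [Set.indicator_of_mem hmem]
      have h1 : Real.exp (l * U ω) ≤ 1 :=
        Real.exp_le_one_iff.2 (mul_nonpos_of_nonneg_of_nonpos hl.le (hU0 ω))
      have h2 : 0 < Real.exp (l * δ) * Real.exp (l * V ω) := by positivity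
      linarith
  refine (integral_mono hiU (hiV.add hiS) hpt).trans ?_
  simp only [Pi.add_apply]
  rw [integral_add hiV hiS, integral_const_mul, integral_indicator_const _ hSm, smul_eq_mul, mul_one]
  linarith

end

section

variable {Ω : ℝ → Type*} [∀ l, MeasurableSpace (Ω l)] {P : ∀ l, Measure (Ω l)}
  {b : ∀ l, ℝ → Ω l → ℝ} {t x : ℝ} {ρ : ℝ → ℝ → ℝ}

/-- The action of the rescaled bridge is exponentially well approximated by the action of its
dyadic polygonal interpolations. -/
theorem exists_measure_polygonalAction_le (ht : 0 < t) (hρ : IsTamePotential ρ t)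
    (hb : ∀ l > 0, IsBrownianBridge t (√l * x) (b l) (P l)) {δ : ℝ} (hδ : 0 < δ) (M : ℝ) :
    ∃ N₀ : ℕ, ∀ N ≥ N₀, ∀ᶠ l in atTop,
      P l {ω | ¬ |(∫ s in (0 : ℝ)..t, ρ s (b l s ω / √l)) -
        polygonalAction ρ t (2 ^ N) (increments t (2 ^ N) fun s => b l s ω / √l)| ≤ δ} ≤
      ENNReal.ofReal (Real.exp (-l * M)) := by
  obtain ⟨η, hη, hunif⟩ := hρ.uniform δ hδ
  have hpow : Tendsto (fun N : ℕ => (2 : ℝ) ^ N) atTop atTop :=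
    tendsto_pow_atTop_atTop_of_one_lt (by norm_num)
  -- The first condition keeps the drift over a cell below `η/4`. With an oscillation of `η/4` this
  -- makes `η/2`, and interpolation doubles it to `η`. The second gives the exponent `l (|M| + 1)`,
  -- whose extra `l` absorbs the factor `2^(N+2)`.
  obtain ⟨N₀, hN₀⟩ := eventually_atTop.1 ((hpow.eventually_ge_atTop (4 * |x| / η)).and
    (hpow.eventually_ge_atTop ((|M| + 1) * (32 * t) / (η / 4) ^ 2)))
  refine ⟨N₀, fun N hN => ?_⟩
  obtain ⟨hNx, hNM⟩ := hN₀ N hN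
  rw [div_le_iff₀ hη] at hNx
  rw [div_le_iff₀ (by positivity)] at hNM
  have hC : |M| + 1 ≤ (η / 4) ^ 2 * 2 ^ N / (32 * t) := by
    rw [le_div_iff₀ (by positivity)]; linarith
  filter_upwards [eventually_ge_atTop 16, eventually_le_exp_mul (2 ^ (N + 2)) one_pos]
    with l hl hlN
  have hl0 : 0 < l := by linarith
  have hbl := hb l hl0
  have e : (η / 4) ^ 2 * l * 2 ^ N / (32 * t) = l * ((η / 4) ^ 2 * 2 ^ N / (32 * t)) := by ring
  have hlC : l * (|M| + 1) ≤ (η / 4) ^ 2 * l * 2 ^ N / (32 * t) := by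
    rw [e]; exact mul_le_mul_of_nonneg_left hC hl0.le
  have hosc := hbl.measure_oscillation_le hl0 ht (η := η / 4) (by positivity) N
    (by nlinarith [abs_nonneg M])
  set Bad := {ω | ¬ ∀ i < 2 ^ N, ∀ s ∈ Set.Icc (node t (2 ^ N) i) (node t (2 ^ N) (i + 1)),
      |(b l s ω / √l - s / t * x) -
        (b l (node t (2 ^ N) i) ω / √l - node t (2 ^ N) i / t * x)| ≤ η / 4} with hBad
  have hsub : {ω | ¬ |(∫ s in (0 : ℝ)..t, ρ s (b l s ω / √l)) -
      polygonalAction ρ t (2 ^ N) (increments t (2 ^ N) fun s => b l s ω / √l)| ≤ δ} ⊆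
      {ω | ¬ (ContinuousOn (fun s => b l s ω) (Set.Icc 0 t) ∧ b l 0 ω = 0)} ∪ Bad := by
    intro ω hω
    by_contra hcon
    simp only [Set.mem_union, hBad, Set.mem_ofPred_eq, not_or, not_not] at hcon
    obtain ⟨⟨hcont, h0⟩, hgood⟩ := hcon
    refine hω ?_
    rw [abs_sub_comm]
    refine hunif _ _ (continuous_polygonal ht _).continuousOn (hcont.div_const _) fun s hs => ?_
    have := abs_polygonal_increments_sub_le ht (n := 2 ^ N) (by positivity)
      (f := fun s => b l s ω / √l) (by simp [h0]) (η := η / 2) (fun i hi u hu => ?_) hs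
    · linarith
    · have h1 := hgood i hi u hu
      have h2 : |(u - node t (2 ^ N) i) / t * x| ≤ η / 4 := by
        have h3 : u - node t (2 ^ N) i ≤ t / 2 ^ N := by
          have h4 := node_succ_sub (t := t) (n := 2 ^ N) i
          push_cast at h4
          linarith [hu.2]
        have h5 : (u - node t (2 ^ N) i) / t ≤ 1 / 2 ^ N := by
          rw [div_le_iff₀ ht]
          calc _ ≤ t / 2 ^ N := h3
            _ = _ := by ring
        have h6 : 0 ≤ (u - node t (2 ^ N) i) / t := div_nonneg (by linarith [hu.1]) ht.le
        rw [abs_mul, abs_of_nonneg h6]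
        calc _ ≤ 1 / 2 ^ N * |x| := mul_le_mul_of_nonneg_right h5 (abs_nonneg x)
          _ ≤ η / 4 := by
            rw [one_div_mul_eq_div, div_le_iff₀ (by positivity)]
            linarith
      have e2 : b l u ω / √l - b l (node t (2 ^ N) i) ω / √l =
          ((b l u ω / √l - u / t * x) -
            (b l (node t (2 ^ N) i) ω / √l - node t (2 ^ N) i / t * x)) +
          (u - node t (2 ^ N) i) / t * x := by ring
      rw [e2]
      exact (abs_add_le _ _).trans (by linarith)
  have hnull : P l {ω | ¬ (ContinuousOn (fun s => b l s ω) (Set.Icc 0 t) ∧ b l 0 ω = 0)} = 0 :=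
    hbl.continuous_paths.and (hbl.ae_zero ht)
  refine (measure_mono hsub).trans ((measure_union_le _ _).trans ?_)
  rw [hnull, zero_add]
  refine hosc.trans (ENNReal.ofReal_le_ofReal ?_)
  calc (2 : ℝ) ^ (N + 2) * Real.exp (-((η / 4) ^ 2 * l * 2 ^ N / (32 * t)))
      ≤ Real.exp (l * 1) * Real.exp (-((η / 4) ^ 2 * l * 2 ^ N / (32 * t))) := by gcongr
    _ ≤ Real.exp (-l * M) := by
      rw [← Real.exp_add]
      refine Real.exp_le_exp.2 ?_
      nlinarith [mul_le_mul_of_nonneg_left (le_abs_self M) hl0.le]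

theorem eventually_integral_expFunctional_le (ht : 0 < t) (hρ : IsTamePotential ρ t)
    (hb : ∀ l > 0, IsBrownianBridge t (√l * x) (b l) (P l)) {ε : ℝ} (hε : 0 < ε) :
    ∀ᶠ l in atTop, ∫ ω, expFunctional (rescale l ρ) t (b l) ω ∂(P l) ≤
      Real.exp (-l * (minEnergy ρ t x - x ^ 2 / (2 * t) - ε)) := by
  set m := minEnergy ρ t x - x ^ 2 / (2 * t) with hm
  -- Taking `M = m` makes the exceptional event no larger than the main term sought.
  obtain ⟨N, hN⟩ := exists_measure_polygonalAction_le ht hρ hb (δ := ε / 4) (by positivity) m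
  have hn : 0 < 2 ^ N := by positivity
  have hF := eventually_integral_exp_le (ε := ε / 4)
    ((continuous_polygonalAction ht hρ (2 ^ N)).comp (continuous_bridgeIncrements t x (2 ^ N)))
    (fun z => hρ.nonpos _) (fun z => minEnergy_sub_le ht hρ x hn z) (by positivity)
  filter_upwards [hN N le_rfl, hF, eventually_gt_atTop 0,
    eventually_le_exp_mul 2 (half_pos hε)] with l h1 h2 hl h3
  have hbl := hb l hl
  have := hbl.isProbabilityMeasure
  have h4 := integral_exp_mul_le_of_measure_le hl (hbl.aestronglyMeasurable_integral ht hρ)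
    (fun ω => hρ.nonpos _) (hbl.aestronglyMeasurable_polygonalAction ht hρ hn)
    (fun ω => hρ.nonpos _) (Real.exp_pos _).le h1
  simp only [expFunctional_rescale]
  rw [hbl.integral_exp_polygonalAction hl ht hρ hn] at h4
  refine h4.trans ?_
  calc _ ≤ Real.exp (l * (ε / 4)) * Real.exp (-l * (m - ε / 4)) + Real.exp (-l * m) := by
        gcongr
        exact h2
    _ ≤ 2 * Real.exp (-l * (m - ε / 2)) := by
        rw [← Real.exp_add, two_mul]
        refine add_le_add (Real.exp_le_exp.2 ?_) (Real.exp_le_exp.2 ?_) <;> nlinarith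
    _ ≤ Real.exp (l * (ε / 2)) * Real.exp (-l * (m - ε / 2)) := by gcongr
    _ ≤ _ := by
        rw [← Real.exp_add]
        refine Real.exp_le_exp.2 ?_
        nlinarith

theorem eventually_le_integral_expFunctional (ht : 0 < t) (hρ : IsTamePotential ρ t)
    (hb : ∀ l > 0, IsBrownianBridge t (√l * x) (b l) (P l)) {ε : ℝ} (hε : 0 < ε) :
    ∀ᶠ l in atTop, Real.exp (-l * (minEnergy ρ t x - x ^ 2 / (2 * t) + ε)) ≤
      ∫ ω, expFunctional (rescale l ρ) t (b l) ω ∂(P l) := by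
  set m := minEnergy ρ t x - x ^ 2 / (2 * t) with hm
  -- One `δ` each for the near-minimizer, its interpolation and the Laplace bound gives `m + 3δ`.
  -- The exceptional event sits at `m + 4δ`, at most half the main term once `exp (l δ) ≥ 2`;
  -- removing it and changing the action bring the total to `m + 5δ`.
  set δ := ε / 5 with hδ
  have hδ0 : 0 < δ := by positivity
  obtain ⟨_, ⟨γ, hγ, rfl⟩, hγE⟩ := exists_lt_of_csInf_lt ((nonempty_H1Path ht x).image (energy ρ t))
    (show sInf (energy ρ t '' H1Path t x) < minEnergy ρ t x + δ from lt_add_of_pos_right _ hδ0)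
  rw [energy_eq ht hρ hγ] at hγE
  have hγc : ContinuousOn γ (Set.Icc 0 t) := by
    have := hγ.1.continuousOn
    rwa [Set.uIcc_of_le ht.le] at this
  obtain ⟨η, hη, hunif⟩ := hρ.uniform δ hδ0
  obtain ⟨n₀, -, hn₀⟩ := exists_forall_abs_polygonal_increments_sub_le ht hγc hγ.2.2.1 hη
  obtain ⟨N₀, hN⟩ := exists_measure_polygonalAction_le ht hρ hb hδ0 (m + 4 * δ)
  set N := max N₀ n₀ with hNdef
  have hn : 0 < 2 ^ N := by positivity
  have hnn : n₀ ≤ 2 ^ N := (le_max_right N₀ n₀).trans Nat.lt_two_pow_self.le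
  have hact := hunif _ _ (continuous_polygonal ht _).continuousOn hγc (hn₀ (2 ^ N) hnn)
  obtain ⟨w, hw1, hw2⟩ := exists_bridgeIncrements_eq ht hn hγ
  have hF := eventually_le_integral_exp
    ((continuous_polygonalAction ht hρ (2 ^ N)).comp (continuous_bridgeIncrements t x (2 ^ N)))
    (fun z => hρ.nonpos _) w hδ0
  have hwm : (∑ i, w i ^ 2) / 2 - polygonalAction ρ t (2 ^ N) (bridgeIncrements t x (2 ^ N) w) + δ ≤
      m + 3 * δ := by
    rw [hw1, polygonalAction]
    linarith [(abs_le.1 hact).1]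
  filter_upwards [hN N (le_max_left _ _), hF, eventually_gt_atTop 0,
    eventually_le_exp_mul 2 hδ0] with l h1 h2 hl h3
  have hbl := hb l hl
  have := hbl.isProbabilityMeasure
  simp only [abs_sub_comm (∫ s in (0 : ℝ)..t, _)] at h1
  have h4 := integral_exp_mul_le_of_measure_le hl
    (hbl.aestronglyMeasurable_polygonalAction ht hρ hn) (fun ω => hρ.nonpos _)
    (hbl.aestronglyMeasurable_integral ht hρ) (fun ω => hρ.nonpos _) (Real.exp_pos _).le h1
  simp only [expFunctional_rescale]
  rw [hbl.integral_exp_polygonalAction hl ht hρ hn] at h4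
  set A := ∫ ω, Real.exp (l * ∫ s in (0 : ℝ)..t, ρ s (b l s ω / √l)) ∂(P l) with hA
  have h5 : Real.exp (-l * (m + 3 * δ)) ≤ Real.exp (l * δ) * A + Real.exp (-l * (m + 4 * δ)) := by
    refine le_trans ((Real.exp_le_exp.2 ?_).trans h2) h4
    simp only [Function.comp_apply]
    nlinarith
  have h6 : Real.exp (-l * (m + 3 * δ)) = Real.exp (l * δ) * Real.exp (-l * (m + 4 * δ)) := by
    rw [← Real.exp_add]; congr 1; ring
  have h7 : Real.exp (-l * (m + 4 * δ)) = Real.exp (l * δ) * Real.exp (-l * (m + 5 * δ)) := by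
    rw [← Real.exp_add]; congr 1; ring
  have h8 : Real.exp (-l * (m + 4 * δ)) ≤ Real.exp (l * δ) * A := by
    rw [h6] at h5
    nlinarith [Real.exp_pos (-l * (m + 4 * δ))]
  rw [h7] at h8
  have h9 := le_of_mul_le_mul_left h8 (Real.exp_pos _)
  have e5 : ε = 5 * δ := by rw [hδ]; ring
  rwa [e5]

theorem tendsto_feynmanKacScaled (ht : 0 < t) (hρ : IsTamePotential ρ t)
    (hb : ∀ l > 0, IsBrownianBridge t (√l * x) (b l) (P l)) :
    Tendsto (fun l => feynmanKacScaled l ρ t x (P l) (b l)) atTop (𝓝 (-minEnergy ρ t x)) := by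
  set m := minEnergy ρ t x - x ^ 2 / (2 * t) with hm
  set A : ℝ → ℝ := fun l => ∫ ω, expFunctional (rescale l ρ) t (b l) ω ∂(P l) with hA
  have h1 : Tendsto (fun l => l⁻¹ * Real.log (A l)) atTop (𝓝 (-m)) := by
    refine Metric.tendsto_nhds.2 fun ε hε => ?_
    filter_upwards [eventually_integral_expFunctional_le ht hρ hb (half_pos hε),
      eventually_le_integral_expFunctional ht hρ hb (half_pos hε), eventually_gt_atTop 0]
      with l hu hl hl0
    have hA0 : 0 < A l := (Real.exp_pos _).trans_le hl
    have hu' := (Real.log_le_iff_le_exp hA0).2 hu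
    have hl' := (Real.le_log_iff_exp_le hA0).2 hl
    rw [← hm] at hu' hl'
    have e : Real.log (A l) = l * (l⁻¹ * Real.log (A l)) := by field_simp
    rw [e] at hu' hl'
    rw [Real.dist_eq]
    refine lt_of_le_of_lt (abs_le.2 ⟨?_, ?_⟩) (half_lt_self hε)
    · refine le_of_mul_le_mul_left ?_ hl0
      linarith
    · refine le_of_mul_le_mul_left ?_ hl0
      linarith
  -- The normalizing constants vanish after division by `l`; the Gaussian exponent leaves exactly
  -- `-x²/(2t)`.
  set C := Real.log (√(4 * Real.pi)) - Real.log (√(2 * Real.pi * t)) with hC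
  have h2 : ∀ l > 0, l⁻¹ * Real.log (√(4 * Real.pi) * heatKernel t (√l * x)) =
      l⁻¹ * C - x ^ 2 / (2 * t) := by
    intro l hl
    have hpi := Real.pi_pos
    have a1 : √(4 * Real.pi) ≠ 0 := (Real.sqrt_pos.2 (by positivity)).ne'
    have a2 : √(2 * Real.pi * t) ≠ 0 := (Real.sqrt_pos.2 (by positivity)).ne'
    rw [heatKernel, Real.log_mul a1 (div_ne_zero (Real.exp_pos _).ne' a2),
      Real.log_div (Real.exp_pos _).ne' a2, Real.log_exp, mul_pow, Real.sq_sqrt hl.le, hC]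
    field_simp
    ring
  have h3 := ((tendsto_inv_atTop_zero.mul_const C).sub_const (x ^ 2 / (2 * t))).add h1
  have e : 0 * C - x ^ 2 / (2 * t) + -m = -minEnergy ρ t x := by rw [hm]; ring
  rw [e] at h3
  refine h3.congr' ?_
  filter_upwards [eventually_gt_atTop 0] with l hl
  rw [feynmanKacScaled, feynmanKac, mul_add, h2 l hl]

end

end WeakNoise

theorem lemma4p2 (r : ℝ → ℝ) (hr : IsOptimalProfile r)
    (t x : ℝ) (ht : 0 < t) (ht2 : t ≤ 2)
    {Ω : ℝ → Type*} [∀ l, MeasurableSpace (Ω l)] (P : ∀ l, Measure (Ω l))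
    (b : ∀ l, ℝ → Ω l → ℝ) (hb : ∀ l > 0, IsBrownianBridge t (√l * x) (b l) (P l)) :
    -- the quantities involved are well defined
    (∀ γ : ℝ → ℝ, ContinuousOn γ (Set.Icc 0 t) →
      IntervalIntegrable (fun s => optimalDeviation r s (γ s)) volume 0 t) ∧
    (∀ l > 0, Integrable (expFunctional (rescale l (optimalDeviation r)) t (b l)) (P l)) ∧
    -- the limit exists and is minus the infimum of the energy
    ∃ h : ℝ,
      Tendsto (fun l => feynmanKacScaled l (optimalDeviation r) t x (P l) (b l)) atTop (𝓝 h) ∧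
      IsGLB (energy (optimalDeviation r) t '' H1Path t x) (-h) := by
  have hρ := hr.isTamePotential ht ht2
  refine ⟨hρ.integrable, fun l hl => ?_, -minEnergy (optimalDeviation r) t x,
    tendsto_feynmanKacScaled ht hρ hb, ?_⟩
  · have := (hb l hl).isProbabilityMeasure
    have h := integrable_exp_mul_of_nonpos hl ((hb l hl).aestronglyMeasurable_integral ht hρ)
      fun ω => hρ.nonpos _
    exact h.congr (Eventually.of_forall fun ω => (expFunctional_rescale l _ t (b l) ω).symm)
  · rw [neg_neg]
    exact isGLB_minEnergy ht hρ x
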